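/- \textbf{Setting.} Let $(x_i,s_i,y_i,R_i)$, $i=1,2,\dots$, be i.i.d. with features $x_i\in\mathbb R^p$, surrogates $s_i=(s_i^{(1)},\dots,s_i^{(K)})\in\mathbb R^K$, label $y_i\in\mathbb R$ and selection indicator $R_i\in\{0,1\}$; let $(x,s,y,R)$ denote a generic copy. Selection for labeling is independent Poisson sampling with a known rule $\rho$: $P(R=1\mid x,s,y)=\rho(x,s)$, where $\varepsilon\le\rho(x,s)\le 1$ for some constant $\varepsilon>0$. For $N\ge 1$ let $\mathcal V=\{i\le N: R_i=1\}$, $n=|\mathcal V|$, and $r=\mathbb E\{\rho(x,s)\}$. Let $m(\beta;y,x)\in\mathbb R^p$ ($\beta\in\mathbb R^p$) and $h(\theta;s^{(k)},x)\in\mathbb R^d$ ($\theta\in\mathbb R^d$) be estimating functions with $\mathbb E\{m(\beta_0;y,x)\}=0$ and $\mathbb E\{h(\theta_0^{(k)};s^{(k)},x)\}=0$, $k=1,\dots,K$. \textbf{Regularity conditions.} For each of the $K+1$ estimating functions $g(b;\cdot)$ (that is, $m$ and $h(\cdot;s^{(k)},x)$, $k\le K$) with true value $b_0$ there is a compact parameter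 set $B$ such that: $g(b;\cdot)$ is measurable for every $b$; $b_0$ is an interior point of $B$ and the only zero in $B$ of $b\mapsto\mathbb E\{g(b)\}$; almost surely $b\mapsto g(b)$ is continuous on $B$, and $\|g(b)\|$, $b\in B$, is bounded by an integrable variable not depending on $b$; $\mathbb E\|g(b_0)\|^2<\infty$; on an open neighbourhood of $b_0$, $g$ is almost surely continuously differentiable in $b$ with derivative bounded in norm by an integrable variable not depending on $b$; and $\mathbb E\{\partial g(b_0)/\partial b^{\mathsf T}\}$ is invertible. The full data influence functions are $\psi=-[\mathbb E\{\partial m(\beta_0;y,x)/\partial\beta^{\mathsf T}\}]^{-1}m(\beta_0;y,x)\in\mathbb R^p$ and $\eta=(\eta^{(1)\mathsf T},\dots,\eta^{(K)\mathsf T})^{\mathsf T}\in\mathbb R^q$, $q=dK$, with $\eta^{(k)}=-[\mathbb E\{\partial h(\theta_0^{(k)};s^{(k)},x)/\partial\theta^{\mathsf T}\}]^{-1}h(\theta_0^{(k)};s^{(k)},x)$. The matrix $\mathbb E\{\frac{1-\rho}{\rho}\eta\eta^{\mathsf T}\}$ is invertible. \textbf{Estimators.} $\hat\beta_{\mathcal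 V}$, $\hat\theta^{(k)}_{\mathcal V}$ and $\hat\theta^{(k)}_{\mathcal F}$ are random vectors which, with probability tending to one as $N\to\infty$, lie in the respective parameter sets and solve $$\frac1N\sum_{i\in\mathcal V}\frac{m(\beta;y_i,x_i)}{\rho(x_i,s_i)}=0,\qquad \frac1N\sum_{i\in\mathcal V}\frac{h(\theta;s_i^{(k)},x_i)}{\rho(x_i,s_i)}=0,\qquad \frac1N\sum_{i=1}^N h(\theta;s_i^{(k)},x_i)=0,$$ respectively; $\hat\theta_{\mathcal V},\hat\theta_{\mathcal F}\in\mathbb R^q$ are the stacked vectors. For a fixed matrix $\Gamma\in\mathbb R^{p\times q}$ put $\hat\beta_\Gamma=\hat\beta_{\mathcal V}-\Gamma(\hat\theta_{\mathcal V}-\hat\theta_{\mathcal F})$ and $$\tilde\psi_\Gamma=\frac{R}{\rho(x,s)}\psi+\frac{\rho(x,s)-R}{\rho(x,s)}\Gamma\eta,\qquad \Sigma_\Gamma=\mathrm{Var}(\tilde\psi_\Gamma),\qquad \Gamma_0=\mathbb E\Bigl\{\frac{1-\rho}{\rho}\psi\eta^{\mathsf T}\Bigr\}\,\mathbb E\Bigl\{\frac{1-\rho}{\rho}\eta\eta^{\mathsf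 T}\Bigr\}^{-1}.$$ \textbf{Theorem.} As $N\to\infty$, $\sqrt n(\hat\beta_\Gamma-\beta_0)\xrightarrow{d}N(0,r\Sigma_\Gamma)$ for every $\Gamma\in\mathbb R^{p\times q}$; in particular this holds for $\hat\beta_{\mathcal V}$ ($\Gamma=0$) and for the Base-SPI estimator $\hat\beta^*_{SPI}=\hat\beta_{\Gamma_0}$. The choice $\Gamma_0$ minimizes the trace of the asymptotic variance: $\mathrm{tr}\,\Sigma_{\Gamma_0}\le\mathrm{tr}\,\Sigma_\Gamma$ for every $\Gamma$. Moreover $$\mathrm{tr}\,\Sigma_{\Gamma_0}=\mathbb E\Bigl\{\frac1\rho\psi^{\mathsf T}\psi\Bigr\}-\mathrm{tr}\Bigl(\mathbb E\Bigl\{\frac{1-\rho}{\rho}\psi\eta^{\mathsf T}\Bigr\}\mathbb E\Bigl\{\frac{1-\rho}{\rho}\eta\eta^{\mathsf T}\Bigr\}^{-1}\mathbb E\Bigl\{\frac{1-\rho}{\rho}\eta\psi^{\mathsf T}\Bigr\}\Bigr)\le\mathbb E\Bigl\{\frac1\rho\psi^{\mathsf T}\psi\Bigr\}=\mathrm{tr}\,\Sigma_0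 .$$ -/

import Mathlib

open MeasureTheory ProbabilityTheory Filter Topology
open scoped Matrix

noncomputable section

/-- `ℝ^k` with its Euclidean norm. -/
abbrev E (k : ℕ) : Type := EuclideanSpace ℝ (Fin k)

/-- The full record `(x, s, y)` of one subject: features `x ∈ ℝ^p`, surrogates `s ∈ ℝ^K`,
label `y ∈ ℝ` (the label is latent for the subjects that are not validated). -/
abbrev Obs (p K : ℕ) : Type := E p × (Fin K → ℝ) × ℝ

variable {Ω : Type*} [MeasurableSpace Ω] {p d K : ℕ}

/-- The selection probability `ρ(x, s)` of a subject with record `(x, s, y)`. -/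
def selProb (ρ : E p → (Fin K → ℝ) → ℝ) (z : Obs p K) : ℝ := ρ z.1 z.2.1

/-- `β ↦ m(β; y, x)` as a function of the record. -/
def labelEq (m : E p → ℝ → E p → E p) : E p → Obs p K → E p := fun b z => m b z.2.2 z.1

/-- `t ↦ h(t; s⁽ᵏ⁾, x)` as a function of the record. -/
def surrEq (h : E d → ℝ → E p → E d) (k : Fin K) : E d → Obs p K → E d :=
  fun t z => h t (z.2.1 k) z.1

/-- The sampling design. The pairs `(Z i, R i)`, `i = 0, 1, …`, are i.i.d., `Z i = (x, s, y)` has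
law `ν`, `R i ∈ {0, 1}` is the indicator of selection for labeling, and, given the record,
the subject is selected with probability `ρ(x, s)`, which is bounded away from zero. -/
structure PoissonDesign (μ : Measure Ω) (Z : ℕ → Ω → Obs p K) (R : ℕ → Ω → ℝ)
    (ν : Measure (Obs p K)) (ρ : E p → (Fin K → ℝ) → ℝ) : Prop where
  measurable_obs : ∀ i, Measurable (Z i)
  measurable_sel : ∀ i, Measurable (R i)
  indep : iIndepFun (fun i ω => (Z i ω, R i ω)) μ
  identDistrib : ∀ i, IdentDistrib (fun ω => (Z i ω, R i ω)) (fun ω => (Z 0 ω, R 0 ω)) μ μ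
  law : μ.map (Z 0) = ν
  sel_zero_or_one : ∀ i ω, R i ω = 0 ∨ R i ω = 1
  measurable_rho : Measurable (selProb ρ : Obs p K → ℝ)
  rho_ge : ∃ ε > 0, ∀ x s, ε ≤ ρ x s
  rho_le : ∀ x s, ρ x s ≤ 1
  sel_prob : ∀ i, μ[R i | MeasurableSpace.comap (Z i) inferInstance]
    =ᵐ[μ] fun ω => selProb ρ (Z i ω)

/-- The validation set `𝒱` among the first `N` subjects. -/
def validSet (R : ℕ → Ω → ℝ) (N : ℕ) (ω : Ω) : Finset ℕ :=
  (Finset.range N).filter (fun i => R i ω = 1)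

/-- `(1/N) ∑_{i ∈ 𝒱} g(b; Zᵢ) / ρ(xᵢ, sᵢ)`: the estimating function on the validation set. -/
def validEq {k : ℕ} (Z : ℕ → Ω → Obs p K) (R : ℕ → Ω → ℝ) (ρ : E p → (Fin K → ℝ) → ℝ)
    (g : E k → Obs p K → E k) (N : ℕ) (b : E k) (ω : Ω) : E k :=
  (1 / (N : ℝ)) • ∑ i ∈ validSet R N ω, (1 / selProb ρ (Z i ω)) • g b (Z i ω)

/-- `(1/N) ∑_{i < N} g(b; Zᵢ)`: the estimating function on the full data. -/
def fullEq {k : ℕ} (Z : ℕ → Ω → Obs p K) (g : E k → Obs p K → E k) (N : ℕ) (b : E k) (ω : Ω) :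
    E k :=
  (1 / (N : ℝ)) • ∑ i ∈ Finset.range N, g b (Z i ω)

/-- `b̂ N`, `N = 0, 1, …`, is an `m`-estimator: a random vector which, with probability tending to
one, lies in the parameter set `B` and solves the estimating equation `eqn N b = 0`. -/
structure IsMEstimator {k : ℕ} (μ : Measure Ω) (eqn : ℕ → E k → Ω → E k) (B : Set (E k))
    (bhat : ℕ → Ω → E k) : Prop where
  aemeasurable : ∀ N, AEMeasurable (bhat N) μ
  solves : Tendsto (fun N => μ {ω | ¬ (bhat N ω ∈ B ∧ eqn N (bhat N ω) ω = 0)}) atTop (𝓝 0)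

/-- The classical regularity conditions for the estimating function `g(b; z)`, `z ∼ ν`, with
parameter set `B` and true value `b₀`. They concern `g`, `ν`, `B`, `b₀` only. -/
structure RegularEq {k : ℕ} (ν : Measure (Obs p K)) (g : E k → Obs p K → E k) (B : Set (E k))
    (b₀ : E k) : Prop where
  measurable : ∀ b, Measurable (g b)
  compact : IsCompact B
  interior : b₀ ∈ interior B
  continuousOn : ∀ᵐ z ∂ν, ContinuousOn (fun b => g b z) B
  envelope : ∃ G : Obs p K → ℝ, Integrable G ν ∧ ∀ᵐ z ∂ν, ∀ b ∈ B, ‖g b z‖ ≤ G z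
  root : ∀ b ∈ B, (∫ z, g b z ∂ν = 0 ↔ b = b₀)
  square : MemLp (g b₀) 2 ν
  smooth : ∃ U : Set (E k), IsOpen U ∧ b₀ ∈ U ∧
    (∀ᵐ z ∂ν, ContDiffOn ℝ 1 (fun b => g b z) U) ∧
    ∃ D : Obs p K → ℝ, Integrable D ν ∧
      ∀ᵐ z ∂ν, ∀ b ∈ U, ‖fderiv ℝ (fun b => g b z) b‖ ≤ D z
  nonsingular : (∫ z, fderiv ℝ (fun b => g b z) b₀ ∂ν).IsInvertible

/-- The full data influence function `-(E ∂g/∂b (b₀; Z))⁻¹ g(b₀; z)` of the `m`-estimator. -/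
def influence {k : ℕ} (ν : Measure (Obs p K)) (g : E k → Obs p K → E k) (b₀ : E k)
    (z : Obs p K) : E k :=
  -(∫ z, fderiv ℝ (fun b => g b z) b₀ ∂ν).inverse (g b₀ z)

/-- The stacked vector `(θ⁽¹⁾ᵀ, …, θ⁽ᴷ⁾ᵀ)ᵀ ∈ ℝ^q`, `q = dK`, with coordinates indexed by `(k, j)`. -/
def stack (θ : Fin K → E d) : Fin K × Fin d → ℝ := fun kj => θ kj.1 kj.2

/-- The surrogate-powered estimator `β̂_𝒱 - Γ (θ̂_𝒱 - θ̂_ℱ)`. -/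
def spi (βV : ℕ → Ω → E p) (θV θF : Fin K → ℕ → Ω → E d)
    (Γ : Matrix (Fin p) (Fin K × Fin d) ℝ) (N : ℕ) (ω : Ω) : E p :=
  βV N ω - WithLp.toLp 2 (Γ *ᵥ (stack (fun k => θV k N ω) - stack (fun k => θF k N ω)))

/-- The matrix `E{(1-ρ)/ρ u vᵀ}`. -/
def wMoment {a b : Type} (ν : Measure (Obs p K)) (ρ : E p → (Fin K → ℝ) → ℝ)
    (u : Obs p K → a → ℝ) (v : Obs p K → b → ℝ) : Matrix a b ℝ :=
  Matrix.of fun i j => ∫ z, (1 - selProb ρ z) / selProb ρ z * (u z i * v z j) ∂ν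

/-- The matrix `Γ₀ = E{(1-ρ)/ρ ψ ηᵀ} E{(1-ρ)/ρ η ηᵀ}⁻¹`. -/
def optGamma (ν : Measure (Obs p K)) (ρ : E p → (Fin K → ℝ) → ℝ)
    (ψ : Obs p K → Fin p → ℝ) (η : Obs p K → Fin K × Fin d → ℝ) :
    Matrix (Fin p) (Fin K × Fin d) ℝ :=
  wMoment ν ρ ψ η * (wMoment ν ρ η η)⁻¹

/-- `ψ̃ = (R/ρ) ψ + ((ρ - R)/ρ) Γ η`, evaluated at one subject with record `z` and selection
indicator `r`. -/
def augInfluence (ρ : E p → (Fin K → ℝ) → ℝ) (ψ : Obs p K → Fin p → ℝ)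
    (η : Obs p K → Fin K × Fin d → ℝ) (Γ : Matrix (Fin p) (Fin K × Fin d) ℝ)
    (z : Obs p K) (r : ℝ) : Fin p → ℝ :=
  (r / selProb ρ z) • ψ z + ((selProb ρ z - r) / selProb ρ z) • (Γ *ᵥ η z)

/-- The covariance matrix `Var(X)` of a random vector. -/
def covMat (μ : Measure Ω) (X : Ω → Fin p → ℝ) : Matrix (Fin p) (Fin p) ℝ :=
  Matrix.of fun i j => cov[fun ω => X ω i, fun ω => X ω j; μ]

/-- `Var(ψ̃)`, where `ψ̃` belongs to the weighting matrix `Γ`. -/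
def asympVar (μ : Measure Ω) (Z : ℕ → Ω → Obs p K) (R : ℕ → Ω → ℝ)
    (ρ : E p → (Fin K → ℝ) → ℝ) (ψ : Obs p K → Fin p → ℝ)
    (η : Obs p K → Fin K × Fin d → ℝ) (Γ : Matrix (Fin p) (Fin K × Fin d) ℝ) :
    Matrix (Fin p) (Fin p) ℝ :=
  covMat μ (fun ω => augInfluence ρ ψ η Γ (Z 0 ω) (R 0 ω))

end

/-!
# Asymptotic normality and efficiency of surrogate-powered estimators

*Asymptotic linearity.* Each of the initial estimators is an `m`-estimator whose estimating equation
has the form `N⁻¹ ∑ wᵢ g(b; Zᵢ) = 0`, with weight `w = R/ρ` on the validation set and `w = 1` on the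
full data. Since `E(R | Z) = ρ`, both weights satisfy `E{w u(Z)} = E{u(Z)}`, so the weighted function
is as regular as `g` and has the same expected derivative (`RegularEq.weighted`). The strong law in
the Banach space of continuous functions on a compact set makes the empirical estimating function and
its derivative converge uniformly, almost surely (`uniform_strong_law`). Hence late roots in the
parameter set are near `b₀`, and the mean value inequality gives the linear expansion
`√N (b̂ - b₀) = N^{-1/2} ∑ wᵢ · influence(Zᵢ) + o_P(1)`
(`RegularEstimating.tendstoInMeasure_sub_sum_influence`).

*Normality.* The estimator with matrix `Γ` is a linear combination of the initial ones, so it is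
asymptotically linear with influence function `ψ̃` (`PoissonDesign.tendstoInMeasure_spi`). The
multivariate central limit theorem gives the limit `N(0, Var ψ̃)` with the normalization `√N`, and
`n / N → r` together with Slutsky's theorem replaces `√N` by `√n`.

*Optimality.* Conditioning on the record gives
`tr Var(ψ̃) = E{ψᵀψ/ρ} - 2 tr(E{(1-ρ)/ρ ψηᵀ} Γᵀ) + tr(Γ E{(1-ρ)/ρ ηηᵀ} Γᵀ)`
(`PoissonDesign.trace_asympVar`), a quadratic function of `Γ`; completing the square shows that it
is smallest at `Γ₀`.
-/

/-! ### A uniform law of large numbers -/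

/-- The evaluations along a dense sequence embed the Polish space `C(S, F)` continuously, hence by
the Lusin-Souslin theorem measurably, into `ℕ → F`. Therefore a map into `C(S, F)` is measurable as
soon as its evaluations are. -/
lemma aemeasurable_continuousMap_of_eval {𝒳 S F : Type*} [MeasurableSpace 𝒳] {P : Measure 𝒳}
    [MetricSpace S] [CompactSpace S] [NormedAddCommGroup F] [CompleteSpace F]
    [SecondCountableTopology F] [MeasurableSpace F] [BorelSpace F]
    [MeasurableSpace C(S, F)] [BorelSpace C(S, F)] {f : 𝒳 → C(S, F)}
    (hf : ∀ s, AEMeasurable (fun x => f x s) P) : AEMeasurable f P := by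
  rcases isEmpty_or_nonempty S with hS | hS
  · have : f = fun _ => 0 := by
      funext x; ext s; exact hS.elim s
    rw [this]; fun_prop
  let e : C(S, F) → ℕ → F := fun φ n => φ (TopologicalSpace.denseSeq S n)
  have he : Continuous e := continuous_pi fun n => continuous_eval_const _
  have hinj : Function.Injective e := by
    intro φ χ hφ
    apply DFunLike.coe_injective
    refine (TopologicalSpace.denseRange_denseSeq S).equalizer φ.continuous χ.continuous ?_
    exact hφ
  have hemb : MeasurableEmbedding e := he.measurableEmbedding hinj
  rw [← hemb.aemeasurable_comp_iff]
  exact aemeasurable_pi_lambda _ fun n => hf _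

/-- The uniform strong law of large numbers over a compact index set: the strong law in the Banach
space of continuous functions on that set. -/
lemma uniform_strong_law {Ω 𝒳 S F : Type*} [MeasurableSpace Ω] {μ : Measure Ω}
    [MeasurableSpace 𝒳] {P : Measure 𝒳} [MetricSpace S] [NormedAddCommGroup F] [NormedSpace ℝ F]
    [CompleteSpace F] [SecondCountableTopology F] [MeasurableSpace F] [BorelSpace F]
    {X : ℕ → Ω → 𝒳} (hX : ∀ i, Measurable (X i)) (hlaw : ∀ i, μ.map (X i) = P)
    (hindep : iIndepFun X μ) {B : Set S} (hB : IsCompact B) {f : S → 𝒳 → F}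
    (hmeas : ∀ s ∈ B, AEMeasurable (f s) P) (hcont : ∀ᵐ x ∂P, ContinuousOn (fun s => f s x) B)
    {D : 𝒳 → ℝ} (hD : Integrable D P) (hbound : ∀ᵐ x ∂P, ∀ s ∈ B, ‖f s x‖ ≤ D x) :
    ContinuousOn (fun s => ∫ x, f s x ∂P) B ∧
    ∀ᵐ ω ∂μ, TendstoUniformlyOn
      (fun (N : ℕ) s => (N : ℝ)⁻¹ • ∑ i ∈ Finset.range N, f s (X i ω))
      (fun s => ∫ x, f s x ∂P) atTop B := by
  have : CompactSpace B := isCompact_iff_compactSpace.1 hB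
  let φ : 𝒳 → C(B, F) := fun x => ContinuousMap.mkD (B.domRestrict fun s => f s x) 0
  have hφ : ∀ x, ContinuousOn (fun s => f s x) B → ∀ s : B, φ x s = f s x := by
    intro x hx s
    exact ContinuousMap.mkD_apply_of_continuous (continuousOn_iff_continuous_domRestrict.1 hx)
  borelize C(B, F)
  have hφm : AEMeasurable φ P := by
    refine aemeasurable_continuousMap_of_eval fun s => (hmeas s s.2).congr ?_
    filter_upwards [hcont] with x hx using (hφ x hx s).symm
  have hφi : Integrable φ P := ⟨hφm.aestronglyMeasurable,
    ContinuousMap.hasFiniteIntegral_mkD_restrict_of_bound (fun x s => f s x) 0 hcont D hD.2 hbound⟩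
  have hint : ∀ s : B, (∫ x, φ x ∂P) s = ∫ x, f s x ∂P := by
    intro s
    rw [ContinuousMap.integral_apply hφi]
    refine integral_congr_ae ?_
    filter_upwards [hcont] with x hx using hφ x hx s
  refine ⟨?_, ?_⟩
  · rw [continuousOn_iff_continuous_domRestrict]
    refine (∫ x, φ x ∂P).continuous.congr fun s => ?_
    simpa using hint s
  have hφm' : ∀ i, AEMeasurable φ (μ.map (X i)) := fun i => by rw [hlaw i]; exact hφm
  have hid : ∀ i, IdentDistrib (X i) (X 0) μ μ := fun i =>
    ⟨(hX i).aemeasurable, (hX 0).aemeasurable, by rw [hlaw, hlaw]⟩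
  have hφi0 : Integrable φ (μ.map (X 0)) := by rw [hlaw]; exact hφi
  have hslln := strong_law_ae (μ := μ) (fun i ω => φ (X i ω))
    (hφi0.comp_measurable (hX 0))
    (fun i j hij => (hindep.indepFun hij).comp₀ (hX i).aemeasurable (hX j).aemeasurable
      (hφm' i) (hφm' j))
    (fun i => (hid i).comp_of_aemeasurable (hφm' i))
  have hmean : ∫ ω, φ (X 0 ω) ∂μ = ∫ x, φ x ∂P := by
    rw [← hlaw 0, integral_map (hX 0).aemeasurable hφi0.1]
  have hgood : ∀ᵐ ω ∂μ, ∀ i, ContinuousOn (fun s => f s (X i ω)) B := by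
    refine ae_all_iff.2 fun i => ?_
    rw [← hlaw i] at hcont
    exact ae_of_ae_map (hX i).aemeasurable hcont
  filter_upwards [hslln, hgood] with ω hω hg
  rw [hmean, ContinuousMap.tendsto_iff_tendstoUniformly] at hω
  rw [tendstoUniformlyOn_iff_tendstoUniformly_comp_coe]
  intro u hu
  filter_upwards [hω u hu] with N hN s
  have h1 := hN s
  simp only [ContinuousMap.coe_smul, ContinuousMap.coe_sum, Pi.smul_apply, Finset.sum_apply,
    hφ _ (hg _), hint] at h1
  exact h1

/-! ### Asymptotic linearity of roots of estimating equations -/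

/-- Sample paths: if random estimating functions and their derivatives converge uniformly, every
late root in the parameter set is close to the true value, and satisfies the linear expansion
around it. -/
lemma eventually_root_expansion {F : Type*} [NormedAddCommGroup F] [NormedSpace ℝ F]
    [FiniteDimensional ℝ F] {B : Set F} {b₀ : F} {δ : ℝ} (hδ : 0 < δ) (hB : IsCompact B)
    {G : ℕ → F → F} {G₀ : F → F} (hG₀ : ContinuousOn G₀ B)
    (hroot : ∀ b ∈ B, G₀ b = 0 → b = b₀) (hG : TendstoUniformlyOn G G₀ atTop B)
    {DG : ℕ → F → F →L[ℝ] F} {DG₀ : F → F →L[ℝ] F}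
    (hderiv : ∀ N, ∀ b ∈ Metric.closedBall b₀ δ, HasFDerivAt (G N) (DG N b) b)
    (hDG : TendstoUniformlyOn DG DG₀ atTop (Metric.closedBall b₀ δ))
    (hDG₀ : ContinuousOn DG₀ (Metric.closedBall b₀ δ)) (hA : (DG₀ b₀).IsInvertible)
    {ε : ℝ} (hε : 0 < ε) :
    ∀ᶠ N in atTop, ∀ b ∈ B, G N b = 0 →
      ‖b - b₀ + (DG₀ b₀).inverse (G N b₀)‖ ≤ ε * ‖G N b₀‖ := by
  set A := DG₀ b₀
  set M := ‖A.inverse‖ + 1 with hM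
  have hM0 : 0 < M := by positivity
  obtain ⟨τ, hτ, hτ1, hτ2⟩ : ∃ τ > 0, M * (2 * τ) ≤ 1 / 2 ∧ 4 * M * M * τ ≤ ε := by
    refine ⟨min (1 / (4 * M)) (ε / (4 * M * M)), by positivity, ?_, ?_⟩
    · calc M * (2 * min (1 / (4 * M)) (ε / (4 * M * M))) ≤ M * (2 * (1 / (4 * M))) := by
            gcongr; exact min_le_left _ _
        _ = 1 / 2 := by field_simp; norm_num
    · calc 4 * M * M * min (1 / (4 * M)) (ε / (4 * M * M))
          ≤ 4 * M * M * (ε / (4 * M * M)) := by gcongr; exact min_le_right _ _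
        _ = ε := by field_simp
  -- a ball on which the limiting derivative is within `τ` of its value at `b₀`
  have hb₀δ : b₀ ∈ Metric.closedBall b₀ δ := Metric.mem_closedBall_self hδ.le
  obtain ⟨δ', hδ', hδ'δ, hclose⟩ : ∃ δ' > 0, δ' ≤ δ ∧ ∀ b ∈ Metric.ball b₀ δ',
      ‖DG₀ b - A‖ ≤ τ := by
    obtain ⟨r, hr, hr'⟩ := Metric.continuousOn_iff.1 hDG₀ b₀ hb₀δ τ hτ
    refine ⟨min r δ, lt_min hr hδ, min_le_right _ _, fun b hb => ?_⟩
    have hb' := Metric.mem_ball.1 hb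
    rw [← dist_eq_norm]
    exact (hr' b (Metric.mem_closedBall.2 (hb'.le.trans (min_le_right _ _)))
      (hb'.trans_le (min_le_left _ _))).le
  -- consistency: away from `b₀` the limit is bounded away from zero
  have hcons : ∀ᶠ N in atTop, ∀ b ∈ B, G N b = 0 → b ∈ Metric.ball b₀ δ' := by
    have hK : IsCompact (B \ Metric.ball b₀ δ') := hB.diff Metric.isOpen_ball
    obtain ⟨c, hc, hcK⟩ : ∃ c > 0, ∀ b ∈ B \ Metric.ball b₀ δ', c ≤ ‖G₀ b‖ := by
      rcases (B \ Metric.ball b₀ δ').eq_empty_or_nonempty with he | hne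
      · exact ⟨1, one_pos, by simp [he]⟩
      obtain ⟨b, hb, hmin⟩ := hK.exists_isMinOn hne ((hG₀.mono Set.sdiff_subset).norm)
      refine ⟨‖G₀ b‖, ?_, fun b' hb' => hmin hb'⟩
      refine norm_pos_iff.2 fun h0 => ?_
      have := hroot b hb.1 h0
      exact hb.2 (this ▸ Metric.mem_ball_self hδ')
    filter_upwards [Metric.tendstoUniformlyOn_iff.1 hG c hc] with N hN b hb h0
    by_contra hcon
    have h1 := hN b hb
    rw [h0, dist_zero_right] at h1
    exact absurd (hcK b ⟨hb, hcon⟩) (not_le.2 h1)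
  filter_upwards [hcons, Metric.tendstoUniformlyOn_iff.1 hDG τ hτ] with N hN hN' b hb h0
  have hbb := hN b hb h0
  have hsub : Metric.ball b₀ δ' ⊆ Metric.closedBall b₀ δ :=
    (Metric.ball_subset_ball hδ'δ).trans Metric.ball_subset_closedBall
  have hmv : ‖G N b - G N b₀ - A (b - b₀)‖ ≤ (2 * τ) * ‖b - b₀‖ := by
    refine (convex_ball b₀ δ').norm_image_sub_le_of_norm_hasFDerivWithin_le'
      (fun x hx => (hderiv N x (hsub hx)).hasFDerivWithinAt) (fun x hx => ?_)
      (Metric.mem_ball_self hδ') hbb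
    have h1 := hN' x (hsub hx)
    rw [dist_eq_norm, norm_sub_rev] at h1
    calc ‖DG N x - A‖ = ‖(DG N x - DG₀ x) + (DG₀ x - A)‖ := by congr 1; abel
      _ ≤ ‖DG N x - DG₀ x‖ + ‖DG₀ x - A‖ := norm_add_le _ _
      _ ≤ τ + τ := add_le_add h1.le (hclose x hx)
      _ = 2 * τ := by ring
  have hinv : A.inverse (A (b - b₀)) = b - b₀ := by
    obtain ⟨e, he⟩ := hA
    rw [← he]; simp
  have hAM : ∀ v, ‖A.inverse v‖ ≤ M * ‖v‖ := fun v =>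
    (A.inverse.le_opNorm v).trans (by gcongr; rw [hM]; linarith)
  have h2 : ‖b - b₀ + A.inverse (G N b₀)‖ ≤ M * (2 * τ) * ‖b - b₀‖ := by
    have : b - b₀ + A.inverse (G N b₀) = -A.inverse (G N b - G N b₀ - A (b - b₀)) := by
      rw [h0, map_sub, map_sub, hinv, map_zero]; abel
    rw [this, norm_neg, mul_assoc]
    exact (hAM _).trans (by gcongr)
  have h3 : ‖b - b₀‖ ≤ 2 * M * ‖G N b₀‖ := by
    have h4 : ‖b - b₀‖ ≤ ‖b - b₀ + A.inverse (G N b₀)‖ + ‖A.inverse (G N b₀)‖ := by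
      calc ‖b - b₀‖ = ‖(b - b₀ + A.inverse (G N b₀)) - A.inverse (G N b₀)‖ := by congr 1; abel
        _ ≤ _ := norm_sub_le _ _
    have h5 := hAM (G N b₀)
    have h6 : M * (2 * τ) * ‖b - b₀‖ ≤ 1 / 2 * ‖b - b₀‖ := by gcongr
    linarith
  calc ‖b - b₀ + A.inverse (G N b₀)‖ ≤ M * (2 * τ) * ‖b - b₀‖ := h2
    _ ≤ M * (2 * τ) * (2 * M * ‖G N b₀‖) := by gcongr
    _ = (4 * M * M * τ) * ‖G N b₀‖ := by ring
    _ ≤ ε * ‖G N b₀‖ := by gcongr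

/-! ### The multivariate central limit theorem -/

section CentralLimit

variable {Ω : Type*} [MeasurableSpace Ω] {μ : Measure Ω} [IsProbabilityMeasure μ] {k : ℕ}

lemma dotProduct_covMat_mulVec {X : Ω → Fin k → ℝ} (hX : ∀ i, MemLp (fun ω => X ω i) 2 μ)
    (t : Fin k → ℝ) : t ⬝ᵥ covMat μ X *ᵥ t = Var[fun ω => ∑ i, t i * X ω i; μ] := by
  rw [variance_fun_sum (fun i => (hX i).const_mul (t i))]
  simp only [dotProduct, Matrix.mulVec, covMat, Matrix.of_apply, Finset.mul_sum,
    covariance_const_mul_left, covariance_const_mul_right]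
  refine Finset.sum_congr rfl fun i _ => Finset.sum_congr rfl fun j _ => ?_
  ring

lemma covMat_posSemidef {X : Ω → Fin k → ℝ} (hX : ∀ i, MemLp (fun ω => X ω i) 2 μ) :
    (covMat μ X).PosSemidef := by
  refine Matrix.PosSemidef.of_dotProduct_mulVec_nonneg ?_ fun t => ?_
  · ext i j
    simp [covMat, covariance_comm]
  · rw [star_trivial, dotProduct_covMat_mulVec hX]
    exact variance_nonneg _ _

/-- The Cramér-Wold device: the characteristic function of a random vector at `t` is that of its
projection on `t` at `1`. -/
lemma charFun_map_eq_charFun_map_inner {Ω : Type*} [MeasurableSpace Ω] {μ : Measure Ω} {k : ℕ}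
    {X : Ω → E k} (hX : AEMeasurable X μ) (t : E k) :
    charFun (μ.map X) t = charFun (μ.map fun ω => inner ℝ (X ω) t) 1 := by
  rw [charFun_apply, charFun_apply, integral_map hX (by fun_prop),
    integral_map (by fun_prop) (by fun_prop)]
  simp

/-- The multivariate central limit theorem, from the one-dimensional one for all projections and
Lévy's convergence theorem. -/
lemma tendstoInDistribution_multivariateGaussian {Y : ℕ → Ω → E k} (hindep : iIndepFun Y μ)
    (hident : ∀ i, IdentDistrib (Y i) (Y 0) μ μ) (hL2 : MemLp (Y 0) 2 μ)
    (hmean : ∫ ω, Y 0 ω ∂μ = 0) :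
    TendstoInDistribution (fun (N : ℕ) ω => (√(N : ℝ))⁻¹ • ∑ i ∈ Finset.range N, Y i ω) atTop id
      (fun _ => μ) (multivariateGaussian 0 (covMat μ fun ω j => Y 0 ω j)) where
  forall_aemeasurable N := AEMeasurable.const_smul
    (Finset.aemeasurable_fun_sum _ fun i _ => (hident i).aemeasurable_fst) (√(N : ℝ))⁻¹
  aemeasurable_limit := aemeasurable_id
  tendsto := by
    have hm : ∀ i, AEMeasurable (Y i) μ := fun i => (hident i).aemeasurable_fst
    refine ProbabilityMeasure.tendsto_iff_tendsto_charFun.2 fun t => ?_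
    have hcoord : ∀ j, MemLp (fun ω => Y 0 ω j) 2 μ := fun j =>
      (EuclideanSpace.proj (𝕜 := ℝ) j).comp_memLp' hL2
    have hinner : MemLp (fun ω => inner ℝ (Y 0 ω) t) 2 μ := hL2.inner_const t
    have hmean' : ∫ ω, inner ℝ (Y 0 ω) t ∂μ = 0 := by
      simp_rw [real_inner_comm t]
      rw [integral_inner (hL2.integrable (by norm_num)), hmean, inner_zero_right]
    have hclt := tendstoInDistribution_inv_sqrt_mul_sum_sub (P := μ)
      (X := fun i ω => inner ℝ (Y i ω) t)
      (Y := id) (P' := gaussianReal 0 Var[fun ω => inner ℝ (Y 0 ω) t; μ].toNNReal)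
      ⟨aemeasurable_id, Measure.map_id⟩ hinner
      (hindep.comp (fun _ y => inner ℝ y t) fun _ => by fun_prop)
      (fun i => (hident i).comp (u := fun y => inner ℝ y t) (by fun_prop))
    have h1 := ProbabilityMeasure.tendsto_iff_tendsto_charFun.1 hclt.tendsto 1
    simp only [ProbabilityMeasure.coe_mk, Measure.map_id] at h1 ⊢
    have hlim : charFun (multivariateGaussian 0 (covMat μ fun ω j => Y 0 ω j)) t =
        charFun (gaussianReal 0 Var[fun ω => inner ℝ (Y 0 ω) t; μ].toNNReal) 1 := by
      rw [charFun_multivariateGaussian (covMat_posSemidef hcoord), charFun_gaussianReal,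
        dotProduct_covMat_mulVec hcoord]
      have : ∀ ω, ∑ i, t i * Y 0 ω i = inner ℝ (Y 0 ω) t := fun ω => by
        simp [PiLp.inner_apply]
      simp [this]
    rw [hlim]
    refine h1.congr fun N => ?_
    rw [charFun_map_eq_charFun_map_inner (X := fun ω => (√(N : ℝ))⁻¹ • ∑ i ∈ Finset.range N, Y i ω)
      (AEMeasurable.const_smul (Finset.aemeasurable_fun_sum _ fun i _ => hm i) (√(N : ℝ))⁻¹)]
    simp [hmean', inner_smul_left, sum_inner]

/-- Scaling of a centered Gaussian vector. -/
lemma map_smul_multivariateGaussian {S : Matrix (Fin k) (Fin k) ℝ} (hS : S.PosSemidef) {r : ℝ}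
    (hr : 0 ≤ r) :
    (multivariateGaussian 0 S).map (fun x => √r • x) = multivariateGaussian 0 (r • S) := by
  have : IsProbabilityMeasure ((multivariateGaussian 0 S).map (fun x => √r • x)) :=
    Measure.isProbabilityMeasure_map (by fun_prop)
  refine Measure.ext_of_charFun (funext fun t => ?_)
  rw [charFun_map_smul, charFun_multivariateGaussian hS,
    charFun_multivariateGaussian (hS.smul hr)]
  have : (√r • t).ofLp ⬝ᵥ S *ᵥ (√r • t).ofLp = t.ofLp ⬝ᵥ (r • S) *ᵥ t.ofLp := by
    simp only [WithLp.ofLp_smul, Matrix.mulVec_smul, smul_dotProduct, dotProduct_smul,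
      Matrix.smul_mulVec, smul_eq_mul]
    rw [← mul_assoc, Real.mul_self_sqrt hr]
  rw [this]
  simp

/-- A sequence that converges in distribution in `ℝ^k` is bounded in probability. -/
lemma TendstoInDistribution.exists_measure_norm_gt_le {Ω' : Type*} [MeasurableSpace Ω']
    {μ' : Measure Ω'} [IsProbabilityMeasure μ'] {X : ℕ → Ω → E k} {Y : Ω' → E k}
    (h : TendstoInDistribution X atTop Y (fun _ => μ) μ') {ε : ENNReal} (hε : 0 < ε) :
    ∃ M > 0, ∀ N, μ {ω | M < ‖X N ω‖} ≤ ε := by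
  have hprob : ∀ N, IsProbabilityMeasure (μ.map (X N)) := fun N =>
    Measure.isProbabilityMeasure_map (h.forall_aemeasurable N)
  have hprob' : IsProbabilityMeasure (μ'.map Y) :=
    Measure.isProbabilityMeasure_map h.aemeasurable_limit
  have htight : IsTightMeasureSet (Set.range fun N => μ.map (X N)) :=
    isTightMeasureSet_of_tendsto_charFun (f := charFun (μ'.map Y)) (by fun_prop)
      (ProbabilityMeasure.tendsto_iff_tendsto_charFun.1 h.tendsto)
  have h1 := tendsto_measure_norm_gt_of_isTightMeasureSet htight
  obtain ⟨M, hM, hM0⟩ := ((h1.eventually_le_const hε).and (eventually_gt_atTop 0)).exists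
  refine ⟨M, hM0, fun N => ?_⟩
  refine le_trans ?_ hM
  refine le_trans ?_ (le_iSup₂ (f := fun (ν : Measure (E k)) _ => ν {x | M < ‖x‖})
    (μ.map (X N)) (Set.mem_range_self N))
  rw [Measure.map_apply_of_aemeasurable (h.forall_aemeasurable N)
    (measurableSet_lt (by fun_prop) (by fun_prop))]
  rfl

end CentralLimit

/-- Slutsky-type comparison: outside events of vanishing probability, the sequence `e` is almost
surely negligible relative to a sequence bounded in probability, hence tends to zero in
probability. -/
lemma tendstoInMeasure_zero_of_le_mul_norm {Ω : Type*} [MeasurableSpace Ω] {μ : Measure Ω}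
    [IsProbabilityMeasure μ] {F : Type*} [NormedAddCommGroup F] [MeasurableSpace F] [BorelSpace F]
    {e S : ℕ → Ω → F} {bad : ℕ → Set Ω}
    (he : ∀ N, AEMeasurable (e N) μ) (hS : ∀ N, AEMeasurable (S N) μ)
    (hbad : Tendsto (fun N => μ (bad N)) atTop (𝓝 0))
    (hle : ∀ᵐ ω ∂μ, ∀ ε > 0, ∀ᶠ N in atTop, ω ∉ bad N → ‖e N ω‖ ≤ ε * ‖S N ω‖)
    (htight : ∀ ε > 0, ∃ M > 0, ∀ N, μ {ω | M < ‖S N ω‖} ≤ ε) :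
    TendstoInMeasure μ e atTop 0 := by
  -- the exceptional events need not be measurable
  let T : ℕ → Set Ω := fun N => toMeasurable μ (bad N)
  let q : ℕ → Ω → ℝ := fun N => (T N)ᶜ.indicator fun ω => ‖e N ω‖ / (1 + ‖S N ω‖)
  have hqm : ∀ N, AEStronglyMeasurable (q N) μ := fun N => by
    have h1 := he N
    have h2 := hS N
    refine AEMeasurable.aestronglyMeasurable (AEMeasurable.indicator ?_
      (measurableSet_toMeasurable _ _).compl)
    exact h1.norm.div (h2.norm.const_add 1)
  have hq : TendstoInMeasure μ q atTop fun _ => 0 := by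
    refine tendstoInMeasure_of_tendsto_ae hqm ?_
    filter_upwards [hle] with ω hω
    rw [Metric.tendsto_nhds]
    intro ε hε
    filter_upwards [hω (ε / 2) (by positivity)] with N hN
    rw [dist_zero_right]
    by_cases hT : ω ∈ T N
    · simp [q, hT, hε]
    · have h1 := hN fun hb => hT (subset_toMeasurable _ _ hb)
      simp only [q, Set.indicator_of_mem (Set.mem_compl hT)]
      rw [Real.norm_of_nonneg (by positivity), div_lt_iff₀ (by positivity)]
      nlinarith [norm_nonneg (S N ω)]
  rw [tendstoInMeasure_iff_norm]
  intro ε hε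
  rw [ENNReal.tendsto_nhds_zero]
  intro τ hτ
  have hτ3 : 0 < τ / 3 := ENNReal.div_pos hτ.ne' (by norm_num)
  obtain ⟨M, hM, hMS⟩ := htight (τ / 3) hτ3
  have hq' := tendstoInMeasure_iff_norm.1 hq (ε / (1 + M)) (by positivity)
  filter_upwards [ENNReal.tendsto_nhds_zero.1 hq' (τ / 3) hτ3,
    ENNReal.tendsto_nhds_zero.1 hbad (τ / 3) hτ3] with N h1 h2
  have hsub : {ω | ε ≤ ‖e N ω - (0 : Ω → F) ω‖} ⊆
      T N ∪ {ω | ε / (1 + M) ≤ ‖q N ω - 0‖} ∪ {ω | M < ‖S N ω‖} := by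
    intro ω hω
    simp only [Pi.zero_apply, sub_zero, Set.mem_ofPred_eq] at hω
    by_contra hcon
    simp only [Set.mem_union, Set.mem_ofPred_eq, sub_zero, not_or, not_le, not_lt] at hcon
    obtain ⟨⟨hT, hqω⟩, hSω⟩ := hcon
    simp only [q, Set.indicator_of_mem (Set.mem_compl hT)] at hqω
    rw [Real.norm_of_nonneg (by positivity), div_lt_div_iff₀ (by positivity) (by positivity)] at hqω
    have : ‖e N ω‖ * (1 + M) ≥ ε * (1 + ‖S N ω‖) := by gcongr
    linarith
  calc μ {ω | ε ≤ ‖e N ω - (0 : Ω → F) ω‖}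
      ≤ μ (T N) + μ {ω | ε / (1 + M) ≤ ‖q N ω - 0‖} + μ {ω | M < ‖S N ω‖} :=
        (measure_mono hsub).trans ((measure_union_le _ _).trans
          (add_le_add_left (measure_union_le _ _) _))
    _ ≤ τ / 3 + τ / 3 + τ / 3 := by
        gcongr
        · rw [measure_toMeasurable]; exact h2
        · exact hMS N
    _ = τ := ENNReal.add_thirds τ

lemma aemeasurable_fderiv_of_differentiableAt {𝒳 : Type*} [MeasurableSpace 𝒳] {P : Measure 𝒳}
    {k : ℕ} {G : E k → 𝒳 → E k} (hG : ∀ b, AEMeasurable (G b) P) {b : E k}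
    (hd : ∀ᵐ x ∂P, DifferentiableAt ℝ (fun b => G b x) b) :
    AEMeasurable (fun x => fderiv ℝ (fun b => G b x) b) P := by
  have happ : ∀ v, AEMeasurable (fun x => fderiv ℝ (fun b => G b x) b v) P := by
    intro v
    refine aemeasurable_of_tendsto_metrizable_ae atTop
      (f := fun (n : ℕ) x => (1 / ((n : ℝ) + 1))⁻¹ • (G (b + (1 / ((n : ℝ) + 1)) • v) x - G b x))
      (fun n => AEMeasurable.const_smul ((hG _).sub (hG _)) ((1 / ((n : ℝ) + 1))⁻¹)) ?_
    filter_upwards [hd] with x hx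
    refine (hx.hasFDerivAt.hasLineDerivAt v).tendsto_slope_zero.comp ?_
    refine tendsto_nhdsWithin_of_tendsto_nhds_of_eventually_within _
      tendsto_one_div_add_atTop_nhds_zero_nat (Eventually.of_forall fun n => ?_)
    exact (Nat.one_div_pos_of_nat (α := ℝ)).ne'
  have hsum : (fun x => fderiv ℝ (fun b => G b x) b) = fun x => ∑ i : Fin k,
      ContinuousLinearMap.smulRightL ℝ (E k) (E k) (EuclideanSpace.proj i)
        (fderiv ℝ (fun b => G b x) b (EuclideanSpace.single i 1)) := by
    funext x
    ext1 v
    simp only [_root_.sum_apply, ContinuousLinearMap.smulRightL_apply_apply,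
      ContinuousLinearMap.smulRight_apply, PiLp.proj_apply]
    conv_lhs => rw [← (EuclideanSpace.basisFun (Fin k) ℝ).sum_repr v]
    simp
  rw [hsum]
  refine Finset.aemeasurable_fun_sum _ fun i _ => ?_
  exact (ContinuousLinearMap.continuous _).measurable.comp_aemeasurable (happ _)

/-- Regularity of an estimating function `G(b; x)`, `x ∼ P`, on an arbitrary sample space: the
counterpart of `RegularEq`, which also covers functions of a record and its selection indicator. -/
structure RegularEstimating {𝒳 : Type*} [MeasurableSpace 𝒳] {k : ℕ} (P : Measure 𝒳)
    (G : E k → 𝒳 → E k) (B : Set (E k)) (b₀ : E k) : Prop where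
  measurable : ∀ b, Measurable (G b)
  compact : IsCompact B
  mem : b₀ ∈ B
  continuousOn : ∀ᵐ x ∂P, ContinuousOn (fun b => G b x) B
  envelope : ∃ D : 𝒳 → ℝ, Integrable D P ∧ ∀ᵐ x ∂P, ∀ b ∈ B, ‖G b x‖ ≤ D x
  root : ∀ b ∈ B, (∫ x, G b x ∂P = 0 ↔ b = b₀)
  square : MemLp (G b₀) 2 P
  smooth : ∃ U : Set (E k), IsOpen U ∧ b₀ ∈ U ∧
    (∀ᵐ x ∂P, ContDiffOn ℝ 1 (fun b => G b x) U) ∧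
    ∃ D : 𝒳 → ℝ, Integrable D P ∧ ∀ᵐ x ∂P, ∀ b ∈ U, ‖fderiv ℝ (fun b => G b x) b‖ ≤ D x
  nonsingular : (∫ x, fderiv ℝ (fun b => G b x) b₀ ∂P).IsInvertible

/-- Almost surely, all late roots of the empirical estimating equation satisfy the linear expansion
around the true value. -/
lemma RegularEstimating.ae_eventually_root_expansion {Ω 𝒳 : Type*} [MeasurableSpace Ω]
    {μ : Measure Ω} [MeasurableSpace 𝒳] {P : Measure 𝒳} {k : ℕ} {G : E k → 𝒳 → E k}
    {B : Set (E k)} {b₀ : E k} (h : RegularEstimating P G B b₀) {X : ℕ → Ω → 𝒳}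
    (hX : ∀ i, Measurable (X i)) (hlaw : ∀ i, μ.map (X i) = P) (hindep : iIndepFun X μ) :
    ∀ᵐ ω ∂μ, ∀ ε > 0, ∀ᶠ (N : ℕ) in atTop, ∀ b ∈ B,
      (N : ℝ)⁻¹ • ∑ i ∈ Finset.range N, G b (X i ω) = 0 →
      ‖b - b₀ + (∫ x, fderiv ℝ (fun b => G b x) b₀ ∂P).inverse
          ((N : ℝ)⁻¹ • ∑ i ∈ Finset.range N, G b₀ (X i ω))‖ ≤
        ε * ‖(N : ℝ)⁻¹ • ∑ i ∈ Finset.range N, G b₀ (X i ω)‖ := by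
  obtain ⟨D, hD, hGD⟩ := h.envelope
  obtain ⟨U, hU, hbU, hdiff, D', hD', hGD'⟩ := h.smooth
  obtain ⟨δ, hδ, hδU⟩ := Metric.nhds_basis_closedBall.mem_iff.1 (hU.mem_nhds hbU)
  have hdiffAt : ∀ᵐ x ∂P, ∀ b ∈ Metric.closedBall b₀ δ,
      DifferentiableAt ℝ (fun b => G b x) b := by
    filter_upwards [hdiff] with x hx b hb
    exact (hx.differentiableOn one_ne_zero).differentiableAt (hU.mem_nhds (hδU hb))
  obtain ⟨hc0, hslln0⟩ := uniform_strong_law hX hlaw hindep h.compact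
    (fun b _ => (h.measurable b).aemeasurable) h.continuousOn hD hGD
  obtain ⟨hc1, hslln1⟩ := uniform_strong_law hX hlaw hindep (isCompact_closedBall b₀ δ)
    (f := fun b x => fderiv ℝ (fun b => G b x) b)
    (fun b hb => aemeasurable_fderiv_of_differentiableAt (fun b => (h.measurable b).aemeasurable)
      (hdiffAt.mono fun x hx => hx b hb))
    (hdiff.mono fun x hx => (hx.continuousOn_fderiv_of_isOpen hU le_rfl).mono hδU) hD'
    (hGD'.mono fun x hx b hb => hx b (hδU hb))
  have hgood : ∀ᵐ ω ∂μ, ∀ i, ∀ b ∈ Metric.closedBall b₀ δ,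
      DifferentiableAt ℝ (fun b => G b (X i ω)) b := by
    refine ae_all_iff.2 fun i => ?_
    rw [← hlaw i] at hdiffAt
    exact ae_of_ae_map (hX i).aemeasurable hdiffAt
  filter_upwards [hslln0, hslln1, hgood] with ω h0 h1 h2 ε hε
  refine eventually_root_expansion hδ h.compact hc0 (fun b hb => (h.root b hb).1) h0
    (fun N b hb => ?_) h1 hc1 h.nonsingular hε
  exact HasFDerivAt.const_smul (HasFDerivAt.fun_sum fun i _ => (h2 i b hb).hasFDerivAt) (N : ℝ)⁻¹

/-- Asymptotic linearity of `m`-estimators: up to a term that vanishes in probability, the scaled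
error is the normalized sum of the influence function. -/
theorem RegularEstimating.tendstoInMeasure_sub_sum_influence {Ω 𝒳 : Type*} [MeasurableSpace Ω]
    {μ : Measure Ω} [IsProbabilityMeasure μ] [MeasurableSpace 𝒳] {P : Measure 𝒳} {k : ℕ}
    {G : E k → 𝒳 → E k} {B : Set (E k)} {b₀ : E k} (h : RegularEstimating P G B b₀)
    {X : ℕ → Ω → 𝒳} (hX : ∀ i, Measurable (X i)) (hlaw : ∀ i, μ.map (X i) = P)
    (hindep : iIndepFun X μ) {bhat : ℕ → Ω → E k}
    (hest : IsMEstimator μ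
      (fun N b ω => (N : ℝ)⁻¹ • ∑ i ∈ Finset.range N, G b (X i ω)) B bhat) :
    TendstoInMeasure μ (fun (N : ℕ) ω => √(N : ℝ) • (bhat N ω - b₀) -
      (√(N : ℝ))⁻¹ • ∑ i ∈ Finset.range N,
        -(∫ x, fderiv ℝ (fun b => G b x) b₀ ∂P).inverse (G b₀ (X i ω))) atTop 0 := by
  set A := ∫ x, fderiv ℝ (fun b => G b x) b₀ ∂P
  have hid : ∀ i, IdentDistrib (X i) (X 0) μ μ := fun i =>
    ⟨(hX i).aemeasurable, (hX 0).aemeasurable, by rw [hlaw, hlaw]⟩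
  have hgm := h.measurable b₀
  have hclt := tendstoInDistribution_multivariateGaussian (μ := μ)
    (Y := fun i ω => G b₀ (X i ω)) (hindep.comp (fun _ => G b₀) fun _ => hgm)
    (fun i => (hid i).comp hgm)
    (by
      have h2 := h.square
      rw [← hlaw 0] at h2
      exact h2.comp_of_map (hX 0).aemeasurable)
    (by
      rw [← integral_map (hX 0).aemeasurable hgm.aestronglyMeasurable, hlaw]
      exact (h.root b₀ h.mem).2 rfl)
  have hSm := hclt.forall_aemeasurable
  have hlin : ∀ (N : ℕ) ω, √(N : ℝ) • (bhat N ω - b₀) -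
      (√(N : ℝ))⁻¹ • ∑ i ∈ Finset.range N, -A.inverse (G b₀ (X i ω)) =
      √(N : ℝ) • (bhat N ω - b₀) +
        A.inverse ((√(N : ℝ))⁻¹ • ∑ i ∈ Finset.range N, G b₀ (X i ω)) := by
    intro N ω
    rw [map_smul, map_sum, Finset.sum_neg_distrib, smul_neg, sub_neg_eq_add]
  simp_rw [hlin]
  refine tendstoInMeasure_zero_of_le_mul_norm (fun N => ?_) hSm hest.solves ?_
    fun ε hε => TendstoInDistribution.exists_measure_norm_gt_le hclt hε
  · exact (AEMeasurable.const_smul ((hest.aemeasurable N).sub_const b₀) (√(N : ℝ))).add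
      (A.inverse.continuous.measurable.comp_aemeasurable (hSm N))
  filter_upwards [h.ae_eventually_root_expansion hX hlaw hindep] with ω hω ε hε
  filter_upwards [hω ε hε, eventually_gt_atTop 0] with N hN hN0 hb
  simp only [not_not] at hb
  have hsN : 0 < √(N : ℝ) := Real.sqrt_pos.2 (by exact_mod_cast hN0)
  have hscale : (√(N : ℝ))⁻¹ = √(N : ℝ) * (N : ℝ)⁻¹ := by
    field_simp
    exact (Real.sq_sqrt (Nat.cast_nonneg N)).symm
  rw [hscale, mul_smul, map_smul, ← smul_add, norm_smul, norm_smul, Real.norm_of_nonneg hsN.le]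
  have := mul_le_mul_of_nonneg_left (hN _ hb.1 hb.2) hsN.le
  linarith

/-! ### The sampling design -/

section Design

variable {Ω : Type*} [MeasurableSpace Ω] {μ : Measure Ω} {p K : ℕ}
  {Z : ℕ → Ω → Obs p K} {R : ℕ → Ω → ℝ} {ν : Measure (Obs p K)} {ρ : E p → (Fin K → ℝ) → ℝ}

lemma PoissonDesign.selProb_pos (hd : PoissonDesign μ Z R ν ρ) (z : Obs p K) :
    0 < selProb ρ z := by
  obtain ⟨ε, hε, h⟩ := hd.rho_ge
  exact hε.trans_le (h _ _)

lemma PoissonDesign.selProb_le_one (hd : PoissonDesign μ Z R ν ρ) (z : Obs p K) :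
    selProb ρ z ≤ 1 := hd.rho_le _ _

lemma PoissonDesign.exists_inv_selProb_le (hd : PoissonDesign μ Z R ν ρ) :
    ∃ C, ∀ z : Obs p K, (selProb ρ z)⁻¹ ≤ C := by
  obtain ⟨ε, hε, h⟩ := hd.rho_ge
  exact ⟨ε⁻¹, fun z => inv_anti₀ hε (h _ _)⟩

lemma PoissonDesign.abs_sel_div_le (hd : PoissonDesign μ Z R ν ρ) :
    ∃ C, ∀ i ω, |R i ω / selProb ρ (Z i ω)| ≤ C := by
  obtain ⟨C, hC⟩ := hd.exists_inv_selProb_le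
  refine ⟨C, fun i ω => ?_⟩
  have hpos := inv_pos.2 (hd.selProb_pos (Z i ω))
  rcases hd.sel_zero_or_one i ω with h | h
  · simpa [h] using hpos.le.trans (hC _)
  · simpa [h, abs_of_pos (hd.selProb_pos (Z i ω))] using hC (Z i ω)

lemma validEq_eq_sum (hd : PoissonDesign μ Z R ν ρ) {k : ℕ} (g : E k → Obs p K → E k) (N : ℕ)
    (b : E k) (ω : Ω) :
    validEq Z R ρ g N b ω = (N : ℝ)⁻¹ •
      ∑ i ∈ Finset.range N, (R i ω / selProb ρ (Z i ω)) • g b (Z i ω) := by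
  rw [validEq, validSet, Finset.sum_filter, one_div]
  congr 1
  refine Finset.sum_congr rfl fun i _ => ?_
  rcases hd.sel_zero_or_one i ω with h | h <;> simp [h]

variable [IsProbabilityMeasure μ]

lemma PoissonDesign.isProbabilityMeasure_law (hd : PoissonDesign μ Z R ν ρ) :
    IsProbabilityMeasure ν := by
  rw [← hd.law]
  exact Measure.isProbabilityMeasure_map (hd.measurable_obs 0).aemeasurable

lemma PoissonDesign.integrable_sel (hd : PoissonDesign μ Z R ν ρ) (i : ℕ) :
    Integrable (R i) μ := by
  refine Integrable.of_bound (hd.measurable_sel i).aestronglyMeasurable 1 (ae_of_all _ fun ω => ?_)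
  rcases hd.sel_zero_or_one i ω with h | h <;> simp [h]

/-- The law of the record of a selected subject has density `ρ` with respect to `ν`. -/
lemma PoissonDesign.map_restrict_selected (hd : PoissonDesign μ Z R ν ρ) :
    (μ.restrict {ω | R 0 ω = 1}).map (Z 0) =
      ν.withDensity fun z => ENNReal.ofReal (selProb ρ z) := by
  have := hd.isProbabilityMeasure_law
  have hZ := hd.measurable_obs 0
  have hS : MeasurableSet {ω | R 0 ω = 1} := hd.measurable_sel 0 (measurableSet_singleton 1)
  have hρi : Integrable (selProb ρ) ν :=
    Integrable.of_bound hd.measurable_rho.aestronglyMeasurable 1 (ae_of_all _ fun z => by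
      rw [Real.norm_of_nonneg (hd.selProb_pos z).le]; exact hd.selProb_le_one z)
  ext A hA
  rw [Measure.map_apply hZ hA, Measure.restrict_apply (hZ hA), withDensity_apply _ hA,
    ← ofReal_integral_eq_lintegral_ofReal hρi.integrableOn
      (ae_of_all _ fun z => (hd.selProb_pos z).le)]
  have h1 : ∫ ω in Z 0 ⁻¹' A, R 0 ω ∂μ = ∫ z in A, selProb ρ z ∂ν := by
    rw [← setIntegral_condExp hZ.comap_le (hd.integrable_sel 0) ⟨A, hA, rfl⟩,
      setIntegral_congr_ae (g := fun ω => selProb ρ (Z 0 ω)) (hZ hA)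
        ((hd.sel_prob 0).mono fun ω h _ => h), ← hd.law,
      setIntegral_map hA hd.measurable_rho.aestronglyMeasurable hZ.aemeasurable]
  have h2 : ∀ ω, R 0 ω = {ω | R 0 ω = 1}.indicator (fun _ => (1 : ℝ)) ω := by
    intro ω
    rcases hd.sel_zero_or_one 0 ω with h | h <;> simp [h]
  rw [← h1]
  rw [setIntegral_congr_fun (hZ hA) fun ω _ => h2 ω, setIntegral_indicator hS, setIntegral_const]
  simp

/-- The tower property of the selection indicator, `E{R u(Z)} = E{ρ u}`. -/
lemma PoissonDesign.integral_sel_smul (hd : PoissonDesign μ Z R ν ρ) {F : Type*}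
    [NormedAddCommGroup F] [NormedSpace ℝ F] {u : Obs p K → F} (hu : AEStronglyMeasurable u ν) :
    ∫ ω, R 0 ω • u (Z 0 ω) ∂μ = ∫ z, selProb ρ z • u z ∂ν := by
  have hS : MeasurableSet {ω | R 0 ω = 1} := hd.measurable_sel 0 (measurableSet_singleton 1)
  have h1 : ∀ ω, R 0 ω • u (Z 0 ω) = {ω | R 0 ω = 1}.indicator (fun ω => u (Z 0 ω)) ω := by
    intro ω
    rcases hd.sel_zero_or_one 0 ω with h | h <;> simp [h]
  simp_rw [h1]
  rw [integral_indicator hS, ← integral_map (μ := μ.restrict {ω | R 0 ω = 1})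
    (hd.measurable_obs 0).aemeasurable, hd.map_restrict_selected,
    integral_withDensity_eq_integral_toReal_smul hd.measurable_rho.ennreal_ofReal
      (ae_of_all _ fun _ => ENNReal.ofReal_lt_top)]
  · refine integral_congr_ae (ae_of_all _ fun z => ?_)
    simp [ENNReal.toReal_ofReal (hd.selProb_pos z).le]
  · rw [hd.map_restrict_selected]
    exact hu.mono_ac (withDensity_absolutelyContinuous _ _)

/-- A weighted estimating function `w g(b; z)` inherits regularity when the weights are bounded and
do not change expectations of functions of the record; its expected derivative is that of `g`. -/
lemma RegularEq.weighted {k : ℕ} {g : E k → Obs p K → E k} {B : Set (E k)} {b₀ : E k}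
    (h : RegularEq ν g B b₀) {P : Measure (Obs p K × ℝ)} (hfst : P.map Prod.fst = ν)
    {w : Obs p K × ℝ → ℝ} (hw : Measurable w) {C : ℝ} (hwC : ∀ᵐ x ∂P, |w x| ≤ C)
    (hmean : ∀ (F : Type) [NormedAddCommGroup F] [NormedSpace ℝ F] (u : Obs p K → F),
      AEStronglyMeasurable u ν → ∫ x, w x • u x.1 ∂P = ∫ z, u z ∂ν) :
    RegularEstimating P (fun b x => w x • g b x.1) B b₀ ∧
      ∫ x, fderiv ℝ (fun b => w x • g b x.1) b₀ ∂P = ∫ z, fderiv ℝ (fun b => g b z) b₀ ∂ν := by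
  have hae : ∀ {q : Obs p K → Prop}, (∀ᵐ z ∂ν, q z) → ∀ᵐ x ∂P, q x.1 := by
    intro q hq
    rw [← hfst] at hq
    exact ae_of_ae_map measurable_fst.aemeasurable hq
  have hint : ∀ {f : Obs p K → ℝ}, Integrable f ν → Integrable (fun x => f x.1) P := by
    intro f hf
    rw [← hfst] at hf
    exact hf.comp_measurable measurable_fst
  have hfd : ∀ x b, fderiv ℝ (fun b => w x • g b x.1) b =
      w x • fderiv ℝ (fun b => g b x.1) b := by
    intro x b
    exact congrFun (fderiv_const_smul_field (f := fun b => g b x.1) (w x)) b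
  obtain ⟨U, hU, hbU, hdiff, D', hD', hgD'⟩ := h.smooth
  have hA : ∫ x, fderiv ℝ (fun b => w x • g b x.1) b₀ ∂P =
      ∫ z, fderiv ℝ (fun b => g b z) b₀ ∂ν := by
    simp_rw [hfd]
    refine hmean _ (fun z => fderiv ℝ (fun b => g b z) b₀) ?_
    refine (aemeasurable_fderiv_of_differentiableAt (fun b => (h.measurable b).aemeasurable)
      ?_).aestronglyMeasurable
    filter_upwards [hdiff] with z hz
    exact (hz.differentiableOn one_ne_zero).differentiableAt (hU.mem_nhds hbU)
  obtain ⟨D, hD, hgD⟩ := h.envelope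
  have hgm : ∀ b, Measurable fun x : Obs p K × ℝ => g b x.1 := fun b =>
    (h.measurable b).comp measurable_fst
  refine ⟨⟨fun b => hw.smul (hgm b), h.compact, interior_subset h.interior, ?_, ?_, ?_, ?_, ?_, ?_⟩,
    hA⟩
  · filter_upwards [hae h.continuousOn] with x hx using ContinuousOn.const_smul hx (w x)
  · refine ⟨fun x => C * D x.1, (hint hD).const_mul C, ?_⟩
    filter_upwards [hwC, hae hgD] with x h1 h2 b hb
    rw [norm_smul]
    exact mul_le_mul h1 (h2 b hb) (norm_nonneg _) ((abs_nonneg _).trans h1)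
  · intro b hb
    rw [hmean _ (g b) (h.measurable b).aestronglyMeasurable]
    exact h.root b hb
  · have h2 : MemLp (fun x : Obs p K × ℝ => g b₀ x.1) 2 P := by
      have h2 := h.square
      rw [← hfst] at h2
      exact h2.comp_of_map measurable_fst.aemeasurable
    refine h2.of_le_mul (c := C) (hw.smul (hgm b₀)).aestronglyMeasurable ?_
    filter_upwards [hwC] with x hx
    rw [norm_smul]
    exact mul_le_mul_of_nonneg_right hx (norm_nonneg _)
  · refine ⟨U, hU, hbU, ?_, fun x => C * D' x.1, (hint hD').const_mul C, ?_⟩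
    · filter_upwards [hae hdiff] with x hx using ContDiffOn.const_smul (w x) hx
    · filter_upwards [hwC, hae hgD'] with x h1 h2 b hb
      rw [hfd, norm_smul]
      exact mul_le_mul h1 (h2 b hb) (norm_nonneg _) ((abs_nonneg _).trans h1)
  · rw [hA]
    exact h.nonsingular

/-- The general expansion of an `m`-estimator whose estimating equation weights the subjects. -/
lemma PoissonDesign.tendstoInMeasure_weighted (hd : PoissonDesign μ Z R ν ρ) {k : ℕ}
    {g : E k → Obs p K → E k} {B : Set (E k)} {b₀ : E k} (h : RegularEq ν g B b₀)
    {w : Obs p K × ℝ → ℝ} (hw : Measurable w) {C : ℝ} (hwC : ∀ ω, |w (Z 0 ω, R 0 ω)| ≤ C)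
    (hmean : ∀ (F : Type) [NormedAddCommGroup F] [NormedSpace ℝ F] (u : Obs p K → F),
      AEStronglyMeasurable u ν → ∫ ω, w (Z 0 ω, R 0 ω) • u (Z 0 ω) ∂μ = ∫ z, u z ∂ν)
    {bhat : ℕ → Ω → E k}
    (hest : IsMEstimator μ (fun (N : ℕ) b ω => (N : ℝ)⁻¹ • ∑ i ∈ Finset.range N,
      w (Z i ω, R i ω) • g b (Z i ω)) B bhat) :
    TendstoInMeasure μ (fun (N : ℕ) ω => √(N : ℝ) • (bhat N ω - b₀) - (√(N : ℝ))⁻¹ •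
      ∑ i ∈ Finset.range N, w (Z i ω, R i ω) • influence ν g b₀ (Z i ω)) atTop 0 := by
  have hXm : ∀ i, Measurable fun ω => (Z i ω, R i ω) := fun i =>
    (hd.measurable_obs i).prodMk (hd.measurable_sel i)
  have hfst : (μ.map fun ω => (Z 0 ω, R 0 ω)).map Prod.fst = ν := by
    rw [Measure.map_map measurable_fst (hXm 0), ← hd.law]
    rfl
  have hwC' : ∀ᵐ x ∂(μ.map fun ω => (Z 0 ω, R 0 ω)), |w x| ≤ C := by
    rw [ae_map_iff (hXm 0).aemeasurable (measurableSet_le (by fun_prop) (by fun_prop))]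
    exact ae_of_all _ hwC
  obtain ⟨hreg, hA⟩ := h.weighted hfst hw hwC' (fun F _ _ u hu => by
    rw [integral_map (hXm 0).aemeasurable]
    · exact hmean F u hu
    · rw [← hfst] at hu
      exact hw.aestronglyMeasurable.smul (hu.comp_measurable measurable_fst))
  have := hreg.tendstoInMeasure_sub_sum_influence hXm (fun i => (hd.identDistrib i).map_eq)
    hd.indep hest
  rw [hA] at this
  refine this.congr_left fun N => ae_of_all _ fun ω => ?_
  simp only [influence, map_smul, smul_neg]

lemma PoissonDesign.tendstoInMeasure_validEq (hd : PoissonDesign μ Z R ν ρ) {k : ℕ}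
    {g : E k → Obs p K → E k} {B : Set (E k)} {b₀ : E k} (h : RegularEq ν g B b₀)
    {bhat : ℕ → Ω → E k} (hest : IsMEstimator μ (validEq Z R ρ g) B bhat) :
    TendstoInMeasure μ (fun (N : ℕ) ω => √(N : ℝ) • (bhat N ω - b₀) - (√(N : ℝ))⁻¹ •
      ∑ i ∈ Finset.range N, (R i ω / selProb ρ (Z i ω)) • influence ν g b₀ (Z i ω)) atTop 0 := by
  obtain ⟨C, hC⟩ := hd.abs_sel_div_le
  have heq : validEq Z R ρ g = fun (N : ℕ) b ω => (N : ℝ)⁻¹ •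
      ∑ i ∈ Finset.range N, (R i ω / selProb ρ (Z i ω)) • g b (Z i ω) := by
    funext (N : ℕ) b ω
    exact validEq_eq_sum hd g N b ω
  rw [heq] at hest
  refine hd.tendstoInMeasure_weighted h (w := fun x => x.2 / selProb ρ x.1)
    (measurable_snd.div (hd.measurable_rho.comp measurable_fst)) (hC 0) ?_ hest
  intro F _ _ u hu
  have hu' : AEStronglyMeasurable (fun z => (selProb ρ z)⁻¹ • u z) ν :=
    hd.measurable_rho.inv.aestronglyMeasurable.smul hu
  calc ∫ ω, (R 0 ω / selProb ρ (Z 0 ω)) • u (Z 0 ω) ∂μ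
      = ∫ ω, R 0 ω • ((selProb ρ (Z 0 ω))⁻¹ • u (Z 0 ω)) ∂μ := by
        simp_rw [div_eq_mul_inv, mul_smul]
    _ = ∫ z, selProb ρ z • ((selProb ρ z)⁻¹ • u z) ∂ν := hd.integral_sel_smul hu'
    _ = ∫ z, u z ∂ν := by
        refine integral_congr_ae (ae_of_all _ fun z => ?_)
        exact smul_inv_smul₀ (hd.selProb_pos z).ne' _

lemma PoissonDesign.tendstoInMeasure_fullEq (hd : PoissonDesign μ Z R ν ρ) {k : ℕ}
    {g : E k → Obs p K → E k} {B : Set (E k)} {b₀ : E k} (h : RegularEq ν g B b₀)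
    {bhat : ℕ → Ω → E k} (hest : IsMEstimator μ (fullEq Z g) B bhat) :
    TendstoInMeasure μ (fun (N : ℕ) ω => √(N : ℝ) • (bhat N ω - b₀) - (√(N : ℝ))⁻¹ •
      ∑ i ∈ Finset.range N, influence ν g b₀ (Z i ω)) atTop 0 := by
  have heq : fullEq Z g = fun (N : ℕ) b ω => (N : ℝ)⁻¹ •
      ∑ i ∈ Finset.range N, (1 : ℝ) • g b (Z i ω) := by
    funext N b ω
    simp [fullEq]
  rw [heq] at hest
  have := hd.tendstoInMeasure_weighted h (w := fun _ => 1) measurable_const (C := 1) (by simp) ?_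
    hest
  · simpa only [one_smul] using this
  intro F _ _ u hu
  rw [← hd.law] at hu ⊢
  rw [integral_map (hd.measurable_obs 0).aemeasurable hu]
  simp

end Design

/-! ### The trace of the asymptotic variance -/

section Trace

variable {Ω : Type*} [MeasurableSpace Ω] {μ : Measure Ω} {p d K : ℕ}
  {Z : ℕ → Ω → Obs p K} {R : ℕ → Ω → ℝ} {ν : Measure (Obs p K)} {ρ : E p → (Fin K → ℝ) → ℝ}

lemma PoissonDesign.integrable_inv_selProb_mul (hd : PoissonDesign μ Z R ν ρ)
    {f : Obs p K → ℝ} (hf : Integrable f ν) : Integrable (fun z => (selProb ρ z)⁻¹ * f z) ν := by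
  obtain ⟨C, hC⟩ := hd.exists_inv_selProb_le
  refine hf.bdd_mul (c := C) hd.measurable_rho.inv.aestronglyMeasurable (ae_of_all _ fun z => ?_)
  rw [Real.norm_of_nonneg (inv_pos.2 (hd.selProb_pos z)).le]
  exact hC z

lemma PoissonDesign.integrable_odds_mul (hd : PoissonDesign μ Z R ν ρ) {f : Obs p K → ℝ}
    (hf : Integrable f ν) : Integrable (fun z => (1 - selProb ρ z) / selProb ρ z * f z) ν := by
  refine ((hd.integrable_inv_selProb_mul hf).sub hf).congr (ae_of_all _ fun z => ?_)
  have := (hd.selProb_pos z).ne'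
  simp only [Pi.sub_apply]
  field_simp

lemma wMoment_transpose {a b : Type} (u : Obs p K → a → ℝ) (v : Obs p K → b → ℝ) :
    (wMoment ν ρ u v)ᵀ = wMoment ν ρ v u := by
  ext i j
  simp only [wMoment, Matrix.transpose_apply, Matrix.of_apply, mul_comm (u _ _)]

lemma wMoment_mulVec_right (hd : PoissonDesign μ Z R ν ρ) {a b c : Type} [Fintype b]
    {u : Obs p K → a → ℝ} {v : Obs p K → b → ℝ} (hu : ∀ i, MemLp (fun z => u z i) 2 ν)
    (hv : ∀ j, MemLp (fun z => v z j) 2 ν) (Γ : Matrix c b ℝ) :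
    wMoment ν ρ u (fun z => Γ *ᵥ v z) = wMoment ν ρ u v * Γᵀ := by
  ext i l
  simp only [wMoment, Matrix.of_apply, Matrix.mul_apply, Matrix.transpose_apply, Matrix.mulVec,
    dotProduct]
  simp_rw [← integral_mul_const]
  rw [← integral_finsetSum]
  · refine integral_congr_ae (ae_of_all _ fun z => ?_)
    simp only [Finset.mul_sum]
    exact Finset.sum_congr rfl fun j _ => by ring
  · intro j _
    exact (hd.integrable_odds_mul ((hu i).integrable_mul (hv j))).mul_const _

lemma wMoment_mulVec_left (hd : PoissonDesign μ Z R ν ρ) {a b c : Type} [Fintype b]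
    {u : Obs p K → a → ℝ} {v : Obs p K → b → ℝ} (hu : ∀ i, MemLp (fun z => u z i) 2 ν)
    (hv : ∀ j, MemLp (fun z => v z j) 2 ν) (Γ : Matrix c b ℝ) :
    wMoment ν ρ (fun z => Γ *ᵥ v z) u = Γ * wMoment ν ρ v u := by
  rw [← wMoment_transpose, wMoment_mulVec_right hd hu hv, Matrix.transpose_mul,
    Matrix.transpose_transpose, wMoment_transpose]

lemma trace_wMoment_self_nonneg (hd : PoissonDesign μ Z R ν ρ) {a : Type} [Fintype a]
    (u : Obs p K → a → ℝ) : 0 ≤ (wMoment ν ρ u u).trace := by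
  refine Finset.sum_nonneg fun i _ => integral_nonneg fun z => ?_
  exact mul_nonneg (div_nonneg (sub_nonneg.2 (hd.selProb_le_one z)) (hd.selProb_pos z).le)
    (mul_self_nonneg _)

lemma memLp_mulVec {b c : Type} [Fintype b] {v : Obs p K → b → ℝ}
    (hv : ∀ j, MemLp (fun z => v z j) 2 ν) (Γ : Matrix c b ℝ) (i : c) :
    MemLp (fun z => (Γ *ᵥ v z) i) 2 ν := by
  simp only [Matrix.mulVec, dotProduct]
  exact memLp_finsetSum _ fun j _ => (hv j).const_mul _

lemma augInfluence_apply (ψ : Obs p K → Fin p → ℝ) (η : Obs p K → Fin K × Fin d → ℝ)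
    (Γ : Matrix (Fin p) (Fin K × Fin d) ℝ) (z : Obs p K) (r : ℝ) (i : Fin p) :
    augInfluence ρ ψ η Γ z r i = r / selProb ρ z * ψ z i +
      (selProb ρ z - r) / selProb ρ z * (Γ *ᵥ η z) i := by
  simp [augInfluence]

variable {ψ : Obs p K → Fin p → ℝ} {η : Obs p K → Fin K × Fin d → ℝ}

lemma PoissonDesign.memLp_augInfluence (hd : PoissonDesign μ Z R ν ρ)
    (hψ : ∀ i, MemLp (fun z => ψ z i) 2 ν) (hη : ∀ j, MemLp (fun z => η z j) 2 ν)
    (Γ : Matrix (Fin p) (Fin K × Fin d) ℝ) (i : Fin p) :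
    MemLp (fun ω => augInfluence ρ ψ η Γ (Z 0 ω) (R 0 ω) i) 2 μ := by
  have hcomp : ∀ {f : Obs p K → ℝ}, MemLp f 2 ν → MemLp (fun ω => f (Z 0 ω)) 2 μ := by
    intro f hf
    rw [← hd.law] at hf
    exact hf.comp_of_map (hd.measurable_obs 0).aemeasurable
  have hρm : Measurable fun ω => selProb ρ (Z 0 ω) := hd.measurable_rho.comp (hd.measurable_obs 0)
  have hRm := hd.measurable_sel 0
  obtain ⟨C, hC⟩ := hd.abs_sel_div_le
  have h1 := hcomp (hψ i)
  have h2 := hcomp (memLp_mulVec hη Γ i)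
  simp only [augInfluence_apply]
  refine MemLp.add (h1.of_le_mul (c := C) ((hRm.div hρm).aestronglyMeasurable.mul h1.1)
    (ae_of_all _ fun ω => ?_)) (h2.of_le_mul (c := 1 + C)
    (((hρm.sub hRm).div hρm).aestronglyMeasurable.mul h2.1) (ae_of_all _ fun ω => ?_))
  · rw [norm_mul]
    exact mul_le_mul_of_nonneg_right (hC 0 ω) (norm_nonneg _)
  · rw [norm_mul, sub_div, div_self (hd.selProb_pos _).ne']
    refine mul_le_mul_of_nonneg_right ((norm_sub_le _ _).trans ?_) (norm_nonneg _)
    rw [norm_one]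
    exact add_le_add_right (hC 0 ω) 1

variable [IsProbabilityMeasure μ]

/-- The augmentation term `((ρ - R)/ρ) c` has mean zero and `R/ρ` mean one given the record. -/
lemma PoissonDesign.integral_augmented (hd : PoissonDesign μ Z R ν ρ) {a c : Obs p K → ℝ}
    (ha : Integrable a ν) (hc : Integrable c ν) :
    ∫ ω, (R 0 ω / selProb ρ (Z 0 ω) * a (Z 0 ω) +
      (selProb ρ (Z 0 ω) - R 0 ω) / selProb ρ (Z 0 ω) * c (Z 0 ω)) ∂μ = ∫ z, a z ∂ν := by
  have hZ := hd.measurable_obs 0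
  have hI : Integrable (fun z => (selProb ρ z)⁻¹ * (a z - c z)) ν :=
    hd.integrable_inv_selProb_mul (ha.sub hc)
  have hIμ : Integrable (fun ω => (selProb ρ (Z 0 ω))⁻¹ * (a (Z 0 ω) - c (Z 0 ω))) μ := by
    rw [← hd.law] at hI
    exact hI.comp_measurable hZ
  have hcμ : Integrable (fun ω => c (Z 0 ω)) μ := by
    rw [← hd.law] at hc
    exact hc.comp_measurable hZ
  have hRI : Integrable
      (fun ω => R 0 ω • ((selProb ρ (Z 0 ω))⁻¹ * (a (Z 0 ω) - c (Z 0 ω)))) μ := by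
    refine hIμ.bdd_mul (c := 1) (hd.measurable_sel 0).aestronglyMeasurable
      (ae_of_all _ fun ω => ?_)
    rcases hd.sel_zero_or_one 0 ω with h | h <;> simp [h]
  calc _ = ∫ ω, (R 0 ω • ((selProb ρ (Z 0 ω))⁻¹ * (a (Z 0 ω) - c (Z 0 ω))) + c (Z 0 ω)) ∂μ := by
        refine integral_congr_ae (ae_of_all _ fun ω => ?_)
        have := (hd.selProb_pos (Z 0 ω)).ne'
        simp only [smul_eq_mul]
        field_simp
        ring
    _ = ∫ z, selProb ρ z • ((selProb ρ z)⁻¹ * (a z - c z)) ∂ν + ∫ z, c z ∂ν := by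
        rw [integral_add hRI hcμ, hd.integral_sel_smul hI.1]
        congr 1
        rw [← hd.law] at hc ⊢
        rw [integral_map hZ.aemeasurable hc.1]
    _ = ∫ z, (a z - c z) ∂ν + ∫ z, c z ∂ν := by
        congr 1
        refine integral_congr_ae (ae_of_all _ fun z => ?_)
        exact mul_inv_cancel_left₀ (hd.selProb_pos z).ne' _
    _ = ∫ z, a z ∂ν := by rw [integral_sub ha hc]; ring

/-- The second moment of `(R/ρ) a + ((ρ - R)/ρ) c`. -/
lemma PoissonDesign.integral_augmented_sq (hd : PoissonDesign μ Z R ν ρ) {a c : Obs p K → ℝ}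
    (ha : MemLp a 2 ν) (hc : MemLp c 2 ν) :
    ∫ ω, (R 0 ω / selProb ρ (Z 0 ω) * a (Z 0 ω) +
      (selProb ρ (Z 0 ω) - R 0 ω) / selProb ρ (Z 0 ω) * c (Z 0 ω)) ^ 2 ∂μ =
    ∫ z, 1 / selProb ρ z * (a z * a z) ∂ν -
      2 * ∫ z, (1 - selProb ρ z) / selProb ρ z * (a z * c z) ∂ν +
      ∫ z, (1 - selProb ρ z) / selProb ρ z * (c z * c z) ∂ν := by
  have haa : Integrable (fun z => a z * a z) ν := ha.integrable_mul ha
  have hac : Integrable (fun z => a z * c z) ν := ha.integrable_mul hc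
  have hcc : Integrable (fun z => c z * c z) ν := hc.integrable_mul hc
  have hI1 := hd.integrable_inv_selProb_mul haa
  have hI2 := hd.integrable_odds_mul hac
  have hI3 := hd.integrable_odds_mul hcc
  -- since `R` is zero or one, the square is itself of the form `(R/ρ) a' + ((ρ - R)/ρ) c'`, with
  -- `c' = c²` (the value at `R = 0`) and `a' = f + c²`
  set f : Obs p K → ℝ := fun z => (selProb ρ z)⁻¹ * (a z * a z) -
      2 * ((1 - selProb ρ z) / selProb ρ z * (a z * c z)) +
      (1 - selProb ρ z) / selProb ρ z * (c z * c z) - c z * c z with hf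
  have hfi : Integrable f ν := ((hI1.sub (hI2.const_mul 2)).add hI3).sub hcc
  have hkey := hd.integral_augmented (a := fun z => f z + c z * c z) (c := fun z => c z * c z)
    (hfi.add hcc) hcc
  calc _ = ∫ ω, (R 0 ω / selProb ρ (Z 0 ω) * (f (Z 0 ω) + c (Z 0 ω) * c (Z 0 ω)) +
      (selProb ρ (Z 0 ω) - R 0 ω) / selProb ρ (Z 0 ω) * (c (Z 0 ω) * c (Z 0 ω))) ∂μ := by
        refine integral_congr_ae (ae_of_all _ fun ω => ?_)
        have := (hd.selProb_pos (Z 0 ω)).ne'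
        simp only [hf]
        rcases hd.sel_zero_or_one 0 ω with h | h <;> rw [h] <;> field_simp <;> ring
    _ = _ := hkey
    _ = ∫ z, ((selProb ρ z)⁻¹ * (a z * a z) -
      2 * ((1 - selProb ρ z) / selProb ρ z * (a z * c z)) +
      (1 - selProb ρ z) / selProb ρ z * (c z * c z)) ∂ν := by
        refine integral_congr_ae (ae_of_all _ fun z => ?_)
        simp only [hf]
        ring
    _ = _ := by
        simp only [one_div]
        rw [← integral_const_mul, ← integral_sub hI1 (hI2.const_mul 2)]
        exact integral_add (hI1.sub (hI2.const_mul 2)) hI3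

lemma PoissonDesign.integral_augInfluence (hd : PoissonDesign μ Z R ν ρ)
    (hψ : ∀ i, MemLp (fun z => ψ z i) 2 ν) (hη : ∀ j, MemLp (fun z => η z j) 2 ν)
    (hψ0 : ∀ i, ∫ z, ψ z i ∂ν = 0) (Γ : Matrix (Fin p) (Fin K × Fin d) ℝ) (i : Fin p) :
    ∫ ω, augInfluence ρ ψ η Γ (Z 0 ω) (R 0 ω) i ∂μ = 0 := by
  have := hd.isProbabilityMeasure_law
  simp only [augInfluence_apply]
  rw [hd.integral_augmented (a := fun z => ψ z i) (c := fun z => (Γ *ᵥ η z) i)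
    ((hψ i).integrable (by norm_num)) ((memLp_mulVec hη Γ i).integrable (by norm_num)), hψ0]

/-- The trace of the asymptotic variance is a quadratic function of the weighting matrix. -/
lemma PoissonDesign.trace_asympVar (hd : PoissonDesign μ Z R ν ρ)
    (hψ : ∀ i, MemLp (fun z => ψ z i) 2 ν) (hη : ∀ j, MemLp (fun z => η z j) 2 ν)
    (hψ0 : ∀ i, ∫ z, ψ z i ∂ν = 0) (Γ : Matrix (Fin p) (Fin K × Fin d) ℝ) :
    (asympVar μ Z R ρ ψ η Γ).trace = ∫ z, 1 / selProb ρ z * (ψ z ⬝ᵥ ψ z) ∂ν -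
      2 * (wMoment ν ρ ψ η * Γᵀ).trace + (Γ * wMoment ν ρ η η * Γᵀ).trace := by
  have hc := memLp_mulVec hη Γ
  have hdiag : ∀ i, asympVar μ Z R ρ ψ η Γ i i =
      ∫ z, 1 / selProb ρ z * (ψ z i * ψ z i) ∂ν -
        2 * wMoment ν ρ ψ (fun z => Γ *ᵥ η z) i i +
        wMoment ν ρ (fun z => Γ *ᵥ η z) (fun z => Γ *ᵥ η z) i i := by
    intro i
    have hm := hd.memLp_augInfluence hψ hη Γ i
    rw [asympVar, covMat, Matrix.of_apply, covariance_self hm.1.aemeasurable,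
      variance_of_integral_eq_zero hm.1.aemeasurable (hd.integral_augInfluence hψ hη hψ0 Γ i)]
    simp only [augInfluence_apply]
    exact hd.integral_augmented_sq (hψ i) (hc i)
  have hsum : ∫ z, 1 / selProb ρ z * (ψ z ⬝ᵥ ψ z) ∂ν =
      ∑ i, ∫ z, 1 / selProb ρ z * (ψ z i * ψ z i) ∂ν := by
    rw [← integral_finsetSum]
    · simp only [dotProduct, Finset.mul_sum]
    · intro i _
      have hI : Integrable (fun z => ψ z i * ψ z i) ν := (hψ i).integrable_mul (hψ i)
      simpa only [one_div] using hd.integrable_inv_selProb_mul hI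
  have h1 : wMoment ν ρ ψ η * Γᵀ = wMoment ν ρ ψ (fun z => Γ *ᵥ η z) :=
    (wMoment_mulVec_right hd hψ hη Γ).symm
  have h2 : Γ * wMoment ν ρ η η * Γᵀ = wMoment ν ρ (fun z => Γ *ᵥ η z) (fun z => Γ *ᵥ η z) := by
    rw [wMoment_mulVec_right hd hc hη, wMoment_mulVec_left hd hη hη]
  rw [h1, h2, hsum]
  simp only [Matrix.trace, Matrix.diag_apply, hdiag, Finset.sum_add_distrib,
    Finset.sum_sub_distrib, Finset.mul_sum]

lemma PoissonDesign.trace_asympVar_zero (hd : PoissonDesign μ Z R ν ρ)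
    (hψ : ∀ i, MemLp (fun z => ψ z i) 2 ν) (hη : ∀ j, MemLp (fun z => η z j) 2 ν)
    (hψ0 : ∀ i, ∫ z, ψ z i ∂ν = 0) :
    (asympVar μ Z R ρ ψ η 0).trace = ∫ z, 1 / selProb ρ z * (ψ z ⬝ᵥ ψ z) ∂ν := by
  rw [hd.trace_asympVar hψ hη hψ0]
  simp

lemma PoissonDesign.trace_asympVar_optGamma (hd : PoissonDesign μ Z R ν ρ)
    (hψ : ∀ i, MemLp (fun z => ψ z i) 2 ν) (hη : ∀ j, MemLp (fun z => η z j) 2 ν)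
    (hψ0 : ∀ i, ∫ z, ψ z i ∂ν = 0) (hinv : IsUnit (wMoment ν ρ η η)) :
    (asympVar μ Z R ρ ψ η (optGamma ν ρ ψ η)).trace =
      ∫ z, 1 / selProb ρ z * (ψ z ⬝ᵥ ψ z) ∂ν -
        (wMoment ν ρ ψ η * (wMoment ν ρ η η)⁻¹ * wMoment ν ρ η ψ).trace := by
  have hdet := (Matrix.isUnit_iff_isUnit_det _).1 hinv
  have hT : (optGamma ν ρ ψ η)ᵀ = (wMoment ν ρ η η)⁻¹ * wMoment ν ρ η ψ := by
    rw [optGamma, Matrix.transpose_mul, Matrix.transpose_nonsing_inv, wMoment_transpose,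
      wMoment_transpose]
  have hC : optGamma ν ρ ψ η * wMoment ν ρ η η = wMoment ν ρ ψ η := by
    rw [optGamma, Matrix.mul_assoc, Matrix.nonsing_inv_mul _ hdet, Matrix.mul_one]
  rw [hd.trace_asympVar hψ hη hψ0, hC, hT, Matrix.mul_assoc]
  ring

/-- Completing the square: the excess of the trace over its value at `Γ₀` is the trace of
`(Γ - Γ₀) E{(1-ρ)/ρ η ηᵀ} (Γ - Γ₀)ᵀ`. -/
lemma PoissonDesign.trace_asympVar_optGamma_le (hd : PoissonDesign μ Z R ν ρ)
    (hψ : ∀ i, MemLp (fun z => ψ z i) 2 ν) (hη : ∀ j, MemLp (fun z => η z j) 2 ν)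
    (hψ0 : ∀ i, ∫ z, ψ z i ∂ν = 0) (hinv : IsUnit (wMoment ν ρ η η))
    (Γ : Matrix (Fin p) (Fin K × Fin d) ℝ) :
    (asympVar μ Z R ρ ψ η (optGamma ν ρ ψ η)).trace ≤ (asympVar μ Z R ρ ψ η Γ).trace := by
  have hdet := (Matrix.isUnit_iff_isUnit_det _).1 hinv
  set Γ₀ := optGamma ν ρ ψ η with hΓ₀
  set W := wMoment ν ρ η η with hW
  have hC : wMoment ν ρ ψ η = Γ₀ * W := by
    rw [hΓ₀, optGamma, Matrix.mul_assoc, Matrix.nonsing_inv_mul _ hdet, Matrix.mul_one]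
  have hWT : Wᵀ = W := wMoment_transpose η η
  have hnn : 0 ≤ ((Γ - Γ₀) * W * (Γ - Γ₀)ᵀ).trace := by
    rw [hW, ← wMoment_mulVec_left hd hη hη,
      ← wMoment_mulVec_right hd (memLp_mulVec hη _) hη]
    exact trace_wMoment_self_nonneg hd _
  have hsymm : (Γ * W * Γ₀ᵀ).trace = (Γ₀ * W * Γᵀ).trace := by
    rw [← Matrix.trace_transpose, Matrix.transpose_mul, Matrix.transpose_mul,
      Matrix.transpose_transpose, hWT, Matrix.mul_assoc]
  rw [hd.trace_asympVar hψ hη hψ0, hd.trace_asympVar hψ hη hψ0, hC]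
  simp only [Matrix.transpose_sub, Matrix.mul_sub, Matrix.sub_mul, Matrix.trace_sub] at hnn
  linarith

end Trace

/-! ### Linear combinations of sequences that vanish in probability -/

section InMeasure

variable {Ω : Type*} [MeasurableSpace Ω] {μ : Measure Ω} {F : Type*} [NormedAddCommGroup F]

lemma tendstoInMeasure_zero_add {e f : ℕ → Ω → F} (he : TendstoInMeasure μ e atTop 0)
    (hf : TendstoInMeasure μ f atTop 0) :
    TendstoInMeasure μ (fun N ω => e N ω + f N ω) atTop 0 := by
  rw [tendstoInMeasure_iff_norm] at he hf ⊢
  intro ε hε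
  have hlim := (he (ε / 2) (by positivity)).add (hf (ε / 2) (by positivity))
  rw [add_zero] at hlim
  refine tendsto_of_tendsto_of_tendsto_of_le_of_le tendsto_const_nhds hlim (fun _ => zero_le)
    fun N => (measure_mono fun ω hω => ?_).trans (measure_union_le _ _)
  by_contra hcon
  simp only [Pi.zero_apply, sub_zero, Set.mem_union, Set.mem_ofPred_eq, not_or, not_le] at hcon hω
  linarith [norm_add_le (e N ω) (f N ω)]

lemma tendstoInMeasure_zero_clm {F' : Type*} [NormedSpace ℝ F] [NormedAddCommGroup F']
    [NormedSpace ℝ F'] {e : ℕ → Ω → F} (he : TendstoInMeasure μ e atTop 0)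
    (L : F →L[ℝ] F') : TendstoInMeasure μ (fun N ω => L (e N ω)) atTop 0 := by
  rw [tendstoInMeasure_iff_norm] at he ⊢
  intro ε hε
  refine tendsto_of_tendsto_of_tendsto_of_le_of_le tendsto_const_nhds
    (he (ε / (‖L‖ + 1)) (by positivity)) (fun _ => zero_le)
    fun N => measure_mono fun ω hω => ?_
  simp only [Pi.zero_apply, sub_zero, Set.mem_ofPred_eq] at hω ⊢
  rw [div_le_iff₀ (by positivity)]
  have := L.le_opNorm (e N ω)
  nlinarith [norm_nonneg (e N ω)]

lemma tendstoInMeasure_zero_sum {ι : Type*} (s : Finset ι) {e : ι → ℕ → Ω → F}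
    (he : ∀ i ∈ s, TendstoInMeasure μ (e i) atTop 0) :
    TendstoInMeasure μ (fun N ω => ∑ i ∈ s, e i N ω) atTop 0 := by
  classical
  induction s using Finset.induction_on with
  | empty =>
    rw [tendstoInMeasure_iff_norm]
    intro ε hε
    simp [not_le.2 hε]
  | insert i s hi ih =>
    simp only [Finset.sum_insert hi]
    exact tendstoInMeasure_zero_add (he i (Finset.mem_insert_self i s))
      (ih fun j hj => he j (Finset.mem_insert_of_mem hj))

end InMeasure

/-! ### Asymptotic normality of the surrogate-powered estimators -/

section Normality

variable {Ω : Type*} [MeasurableSpace Ω] {μ : Measure Ω} {p d K : ℕ}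
  {Z : ℕ → Ω → Obs p K} {R : ℕ → Ω → ℝ} {ν : Measure (Obs p K)} {ρ : E p → (Fin K → ℝ) → ℝ}

/-- The action `v ↦ Γ₍ₖ₎ v` of the `k`-th column block of `Γ`, which multiplies the `k`-th surrogate
parameter in `Γ θ`. -/
noncomputable def blockMap (Γ : Matrix (Fin p) (Fin K × Fin d) ℝ) (k : Fin K) : E d →L[ℝ] E p :=
  LinearMap.toContinuousLinearMap (Matrix.toEuclideanLin (Γ.submatrix id (Prod.mk k)))

lemma toLp_mulVec_stack (Γ : Matrix (Fin p) (Fin K × Fin d) ℝ) (θ : Fin K → E d) :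
    WithLp.toLp 2 (Γ *ᵥ stack θ) = ∑ k, blockMap Γ k (θ k) := by
  ext i
  simp [blockMap, Matrix.mulVec, dotProduct, Fintype.sum_prod_type, stack]

lemma RegularEq.memLp_influence {k : ℕ} {g : E k → Obs p K → E k} {B : Set (E k)} {b₀ : E k}
    (h : RegularEq ν g B b₀) : MemLp (influence ν g b₀) 2 ν :=
  (ContinuousLinearMap.comp_memLp' (∫ z, fderiv ℝ (fun b => g b z) b₀ ∂ν).inverse h.square).neg

lemma RegularEq.integral_influence [IsProbabilityMeasure ν] {k : ℕ} {g : E k → Obs p K → E k}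
    {B : Set (E k)} {b₀ : E k} (h : RegularEq ν g B b₀) : ∫ z, influence ν g b₀ z ∂ν = 0 := by
  have h0 : ∫ z, g b₀ z ∂ν = 0 := (h.root b₀ (interior_subset h.interior)).2 rfl
  simp only [influence]
  rw [integral_neg, ContinuousLinearMap.integral_comp_comm _ (h.square.integrable (by norm_num)),
    h0, map_zero, neg_zero]

lemma PoissonDesign.measurable_card_validSet (hd : PoissonDesign μ Z R ν ρ) (N : ℕ) :
    Measurable fun ω => ((validSet R N ω).card : ℝ) := by
  simp only [validSet, Finset.card_filter, Nat.cast_sum]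
  refine Finset.measurable_fun_sum _ fun i _ => ?_
  have : (fun ω => (((if R i ω = 1 then 1 else 0 : ℕ)) : ℝ)) = R i := by
    funext ω
    rcases hd.sel_zero_or_one i ω with h | h <;> simp [h]
  rw [this]
  exact hd.measurable_sel i

variable [IsProbabilityMeasure μ] {m : E p → ℝ → E p → E p} {B : Set (E p)} {β₀ : E p}
  {h : E d → ℝ → E p → E d} {T : Fin K → Set (E d)} {θ₀ : Fin K → E d}
  {βV : ℕ → Ω → E p} {θV θF : Fin K → ℕ → Ω → E d}

/-- The expansions of the initial estimators combine: the estimator with weighting matrix `Γ` is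
asymptotically linear with influence function `ψ̃`. -/
lemma PoissonDesign.tendstoInMeasure_spi (hd : PoissonDesign μ Z R ν ρ)
    (hm : RegularEq ν (labelEq m) B β₀) (hh : ∀ k, RegularEq ν (surrEq h k) (T k) (θ₀ k))
    (hβV : IsMEstimator μ (validEq Z R ρ (labelEq m)) B βV)
    (hθV : ∀ k, IsMEstimator μ (validEq Z R ρ (surrEq h k)) (T k) (θV k))
    (hθF : ∀ k, IsMEstimator μ (fullEq Z (surrEq h k)) (T k) (θF k))
    (Γ : Matrix (Fin p) (Fin K × Fin d) ℝ) :
    TendstoInMeasure μ (fun (N : ℕ) ω => √(N : ℝ) • (spi βV θV θF Γ N ω - β₀) -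
      (√(N : ℝ))⁻¹ • ∑ i ∈ Finset.range N, WithLp.toLp 2 (augInfluence ρ
        (fun z i => influence ν (labelEq m) β₀ z i)
        (fun z => stack (fun k => influence ν (surrEq h k) (θ₀ k) z)) Γ (Z i ω) (R i ω)))
      atTop 0 := by
  have hlim := tendstoInMeasure_zero_add (hd.tendstoInMeasure_validEq hm hβV)
    (tendstoInMeasure_zero_add
      (tendstoInMeasure_zero_sum Finset.univ fun k _ =>
        tendstoInMeasure_zero_clm (hd.tendstoInMeasure_fullEq (hh k) (hθF k)) (blockMap Γ k))
      (tendstoInMeasure_zero_sum Finset.univ fun k _ =>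
        tendstoInMeasure_zero_clm (hd.tendstoInMeasure_validEq (hh k) (hθV k)) (-blockMap Γ k)))
  refine hlim.congr_left fun N => ae_of_all _ fun ω => ?_
  have haug : ∀ i, WithLp.toLp 2 (augInfluence ρ
        (fun z i => influence ν (labelEq m) β₀ z i)
        (fun z => stack (fun k => influence ν (surrEq h k) (θ₀ k) z)) Γ (Z i ω) (R i ω)) =
      (R i ω / selProb ρ (Z i ω)) • influence ν (labelEq m) β₀ (Z i ω) -
      ∑ k, blockMap Γ k
        ((R i ω / selProb ρ (Z i ω)) • influence ν (surrEq h k) (θ₀ k) (Z i ω)) +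
      ∑ k, blockMap Γ k (influence ν (surrEq h k) (θ₀ k) (Z i ω)) := by
    intro i
    have hρ := (hd.selProb_pos (Z i ω)).ne'
    have h1 : (selProb ρ (Z i ω) - R i ω) / selProb ρ (Z i ω) =
        1 - R i ω / selProb ρ (Z i ω) := by field_simp
    simp only [augInfluence, WithLp.toLp_add, WithLp.toLp_smul, toLp_mulVec_stack, h1, map_smul,
      ← Finset.smul_sum]
    module
  have hsum : ∑ i ∈ Finset.range N, WithLp.toLp 2 (augInfluence ρ
        (fun z i => influence ν (labelEq m) β₀ z i)
        (fun z => stack (fun k => influence ν (surrEq h k) (θ₀ k) z)) Γ (Z i ω) (R i ω)) =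
      ∑ i ∈ Finset.range N,
        (R i ω / selProb ρ (Z i ω)) • influence ν (labelEq m) β₀ (Z i ω) -
      ∑ k, blockMap Γ k (∑ i ∈ Finset.range N,
        (R i ω / selProb ρ (Z i ω)) • influence ν (surrEq h k) (θ₀ k) (Z i ω)) +
      ∑ k, blockMap Γ k (∑ i ∈ Finset.range N,
        influence ν (surrEq h k) (θ₀ k) (Z i ω)) := by
    simp only [haug, Finset.sum_add_distrib, Finset.sum_sub_distrib, map_sum]
    rw [Finset.sum_comm (s := Finset.range N), Finset.sum_comm (s := Finset.range N)]
  have hstack : stack (fun k => θV k N ω) - stack (fun k => θF k N ω) =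
      stack fun k => θV k N ω - θF k N ω := rfl
  beta_reduce
  rw [hsum, spi, hstack, toLp_mulVec_stack]
  simp only [_root_.neg_apply, map_sub, map_smul, Finset.sum_sub_distrib,
    Finset.sum_neg_distrib, ← Finset.smul_sum]
  module

/-- The fraction of selected subjects tends to `r = E ρ`. -/
lemma PoissonDesign.ae_tendsto_card_validSet_div (hd : PoissonDesign μ Z R ν ρ) :
    ∀ᵐ ω ∂μ, Tendsto (fun N : ℕ => ((validSet R N ω).card : ℝ) / N) atTop
      (𝓝 (∫ z, selProb ρ z ∂ν)) := by
  have hmean : ∫ ω, R 0 ω ∂μ = ∫ z, selProb ρ z ∂ν := by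
    simpa using hd.integral_sel_smul (u := fun _ => (1 : ℝ)) aestronglyMeasurable_const
  have hslln := strong_law_ae_real R (hd.integrable_sel 0)
    (fun i j hij => ((hd.indep.comp (fun _ x => x.2) fun _ => measurable_snd).indepFun hij))
    (fun i => (hd.identDistrib i).comp measurable_snd)
  rw [hmean] at hslln
  filter_upwards [hslln] with ω hω
  refine hω.congr fun N => ?_
  rw [validSet, Finset.card_filter, Nat.cast_sum]
  congr 1
  refine Finset.sum_congr rfl fun i _ => ?_
  rcases hd.sel_zero_or_one i ω with h | h <;> simp [h]

lemma measurable_augInfluence (hρ : Measurable (selProb ρ : Obs p K → ℝ))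
    {ψ : Obs p K → Fin p → ℝ} {η : Obs p K → Fin K × Fin d → ℝ}
    (hψ : ∀ i, Measurable fun z => ψ z i) (hη : ∀ j, Measurable fun z => η z j)
    (Γ : Matrix (Fin p) (Fin K × Fin d) ℝ) :
    Measurable fun x : Obs p K × ℝ => WithLp.toLp 2 (augInfluence ρ ψ η Γ x.1 x.2) := by
  have hρ' : Measurable fun x : Obs p K × ℝ => selProb ρ x.1 := hρ.comp measurable_fst
  refine (WithLp.measurable_toLp 2 _).comp (measurable_pi_lambda _ fun i => ?_)
  simp only [augInfluence_apply, Matrix.mulVec, dotProduct]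
  refine ((measurable_snd.div hρ').mul ((hψ i).comp measurable_fst)).add
    (((hρ'.sub measurable_snd).div hρ').mul (Finset.measurable_fun_sum _ fun j _ => ?_))
  exact ((hη j).comp measurable_fst).const_mul _

/-- The central limit theorem for the influence function `ψ̃`. -/
lemma PoissonDesign.tendstoInDistribution_sum_augInfluence (hd : PoissonDesign μ Z R ν ρ)
    {ψ : Obs p K → Fin p → ℝ} {η : Obs p K → Fin K × Fin d → ℝ}
    (hψm : ∀ i, Measurable fun z => ψ z i) (hηm : ∀ j, Measurable fun z => η z j)
    (hψ : ∀ i, MemLp (fun z => ψ z i) 2 ν) (hη : ∀ j, MemLp (fun z => η z j) 2 ν)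
    (hψ0 : ∀ i, ∫ z, ψ z i ∂ν = 0) (Γ : Matrix (Fin p) (Fin K × Fin d) ℝ) :
    TendstoInDistribution (fun (N : ℕ) ω => (√(N : ℝ))⁻¹ • ∑ i ∈ Finset.range N,
        WithLp.toLp 2 (augInfluence ρ ψ η Γ (Z i ω) (R i ω))) atTop id
      (fun _ => μ) (multivariateGaussian 0 (asympVar μ Z R ρ ψ η Γ)) := by
  have hmeas := measurable_augInfluence hd.measurable_rho hψm hηm Γ
  have hL2 : MemLp (fun ω => WithLp.toLp 2 (augInfluence ρ ψ η Γ (Z 0 ω) (R 0 ω))) 2 μ :=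
    MemLp.of_eval_piLp fun i => hd.memLp_augInfluence hψ hη Γ i
  refine tendstoInDistribution_multivariateGaussian
    (Y := fun i ω => WithLp.toLp 2 (augInfluence ρ ψ η Γ (Z i ω) (R i ω)))
    (hd.indep.comp (fun _ x => WithLp.toLp 2 (augInfluence ρ ψ η Γ x.1 x.2)) fun _ => hmeas)
    (fun i => (hd.identDistrib i).comp hmeas) hL2 ?_
  ext i
  rw [eval_integral_piLp fun i =>
    (hd.memLp_augInfluence hψ hη Γ i).integrable (by norm_num)]
  exact hd.integral_augInfluence hψ hη hψ0 Γ i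

/-- Asymptotic normality with the random normalization `√n`: since `n / N → r`, Slutsky's theorem
turns the limit `N(0, Σ)` of `√N (β̂ - β₀)` into `N(0, r Σ)`. -/
lemma PoissonDesign.tendstoInDistribution_sqrt_card_smul (hd : PoissonDesign μ Z R ν ρ)
    {bhat : ℕ → Ω → E p} {b₀ : E p} {S : Matrix (Fin p) (Fin p) ℝ} (hS : S.PosSemidef)
    (hlim : TendstoInDistribution (fun (N : ℕ) ω => √(N : ℝ) • (bhat N ω - b₀)) atTop id
      (fun _ => μ) (multivariateGaussian 0 S)) :
    TendstoInDistribution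
      (fun N ω => √((validSet R N ω).card : ℝ) • (bhat N ω - b₀)) atTop id (fun _ => μ)
      (multivariateGaussian 0 ((∫ z, selProb ρ z ∂ν) • S)) := by
  have hr : 0 ≤ ∫ z, selProb ρ z ∂ν := integral_nonneg fun z => (hd.selProb_pos z).le
  have hfm : ∀ N : ℕ, Measurable fun ω => √(((validSet R N ω).card : ℝ) / N) := fun N =>
    ((hd.measurable_card_validSet N).div_const _).sqrt
  have hf : TendstoInMeasure μ (fun (N : ℕ) ω => √(((validSet R N ω).card : ℝ) / N)) atTop
      fun _ => √(∫ z, selProb ρ z ∂ν) := by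
    refine tendstoInMeasure_of_tendsto_ae (fun N => (hfm N).aestronglyMeasurable) ?_
    filter_upwards [hd.ae_tendsto_card_validSet_div] with ω hω using hω.sqrt
  have h1 := hlim.continuous_comp_prodMk_of_tendstoInMeasure_const
    (g := fun x : E p × ℝ => x.2 • x.1) (by fun_prop) hf fun N => (hfm N).aemeasurable
  have h2 : (fun (N : ℕ) ω => √(((validSet R N ω).card : ℝ) / N) •
      √(N : ℝ) • (bhat N ω - b₀)) =
      fun N ω => √((validSet R N ω).card : ℝ) • (bhat N ω - b₀) := by
    funext N ω
    rw [smul_smul, ← Real.sqrt_mul (by positivity)]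
    rcases Nat.eq_zero_or_pos N with h0 | h0
    · simp [h0, validSet]
    · rw [div_mul_cancel₀ _ (by exact_mod_cast h0.ne')]
  rw [h2] at h1
  refine ⟨h1.forall_aemeasurable, aemeasurable_id, ?_⟩
  have h3 : (multivariateGaussian 0 ((∫ z, selProb ρ z ∂ν) • S)).map id =
      (multivariateGaussian 0 S).map fun x => √(∫ z, selProb ρ z ∂ν) • id x := by
    rw [Measure.map_id]
    exact (map_smul_multivariateGaussian hS hr).symm
  convert h1.tendsto using 2
  exact congrArg 𝓝 (Subtype.ext h3)

end Normality

theorem theorem1 {Ω : Type*} [MeasurableSpace Ω] (μ : Measure Ω) [IsProbabilityMeasure μ]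
    {p d K : ℕ}
    -- the data and the selection rule
    (Z : ℕ → Ω → Obs p K) (R : ℕ → Ω → ℝ) (ν : Measure (Obs p K))
    (ρ : E p → (Fin K → ℝ) → ℝ) (hdesign : PoissonDesign μ Z R ν ρ)
    -- the estimating functions, the parameter sets and the true parameters
    (m : E p → ℝ → E p → E p) (B : Set (E p)) (β₀ : E p)
    (hm : RegularEq ν (labelEq m) B β₀)
    (h : E d → ℝ → E p → E d) (T : Fin K → Set (E d)) (θ₀ : Fin K → E d)
    (hh : ∀ k, RegularEq ν (surrEq h k) (T k) (θ₀ k))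
    -- the estimators on the validation set and on the full data
    (βV : ℕ → Ω → E p) (hβV : IsMEstimator μ (validEq Z R ρ (labelEq m)) B βV)
    (θV θF : Fin K → ℕ → Ω → E d)
    (hθV : ∀ k, IsMEstimator μ (validEq Z R ρ (surrEq h k)) (T k) (θV k))
    (hθF : ∀ k, IsMEstimator μ (fullEq Z (surrEq h k)) (T k) (θF k))
    -- the full data influence functions
    (ψ : Obs p K → Fin p → ℝ) (hψ : ψ = fun z i => influence ν (labelEq m) β₀ z i)
    (η : Obs p K → Fin K × Fin d → ℝ)
    (hη : η = fun z => stack (fun k => influence ν (surrEq h k) (θ₀ k) z))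
    -- the matrix that is inverted in `Γ₀` is invertible
    (hinv : IsUnit (wMoment ν ρ η η)) :
    -- every surrogate-powered estimator (Base-SPI, `Γ = Γ₀`, and `β̂_𝒱`, `Γ = 0`, included) is
    -- asymptotically normal with asymptotic variance `r Var(ψ̃)`, `r = E ρ(x, s)`
    (∀ Γ : Matrix (Fin p) (Fin K × Fin d) ℝ,
      TendstoInDistribution
        (fun N ω => √((validSet R N ω).card : ℝ) • (spi βV θV θF Γ N ω - β₀))
        atTop id (fun _ => μ)
        (multivariateGaussian 0 ((∫ z, selProb ρ z ∂ν) • asympVar μ Z R ρ ψ η Γ))) ∧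
    -- `Γ₀` minimizes the trace of the asymptotic variance over the class
    (∀ Γ : Matrix (Fin p) (Fin K × Fin d) ℝ,
      (asympVar μ Z R ρ ψ η (optGamma ν ρ ψ η)).trace ≤ (asympVar μ Z R ρ ψ η Γ).trace) ∧
    -- the trace formula for Base-SPI
    (asympVar μ Z R ρ ψ η (optGamma ν ρ ψ η)).trace =
      (∫ z, 1 / selProb ρ z * (ψ z ⬝ᵥ ψ z) ∂ν) -
        (wMoment ν ρ ψ η * (wMoment ν ρ η η)⁻¹ * wMoment ν ρ η ψ).trace ∧
    -- the trace for `β̂_𝒱`; Base-SPI does no harm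
    (asympVar μ Z R ρ ψ η 0).trace = ∫ z, 1 / selProb ρ z * (ψ z ⬝ᵥ ψ z) ∂ν ∧
    (asympVar μ Z R ρ ψ η (optGamma ν ρ ψ η)).trace ≤ (asympVar μ Z R ρ ψ η 0).trace := by
  have hprob := hdesign.isProbabilityMeasure_law
  have hinfm : ∀ {k : ℕ} {g : E k → Obs p K → E k} {B : Set (E k)} {b₀ : E k},
      RegularEq ν g B b₀ → Measurable (influence ν g b₀) := by
    intro k g B b₀ hg
    exact ((ContinuousLinearMap.continuous _).measurable.comp (hg.measurable b₀)).neg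
  have hψm : ∀ i, Measurable fun z => ψ z i := by
    intro i
    simp only [hψ]
    exact (PiLp.continuous_apply 2 _ i).measurable.comp (hinfm hm)
  have hηm : ∀ j, Measurable fun z => η z j := by
    intro j
    simp only [hη, stack]
    exact (PiLp.continuous_apply 2 _ j.2).measurable.comp (hinfm (hh j.1))
  have hψ2 : ∀ i, MemLp (fun z => ψ z i) 2 ν := by
    intro i
    simp only [hψ]
    exact (EuclideanSpace.proj (𝕜 := ℝ) i).comp_memLp' hm.memLp_influence
  have hη2 : ∀ j, MemLp (fun z => η z j) 2 ν := by
    intro j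
    simp only [hη, stack]
    exact (EuclideanSpace.proj (𝕜 := ℝ) j.2).comp_memLp' (hh j.1).memLp_influence
  have hψ0 : ∀ i, ∫ z, ψ z i ∂ν = 0 := by
    intro i
    have h1 := (EuclideanSpace.proj (𝕜 := ℝ) i).integral_comp_comm
      (hm.memLp_influence.integrable (by norm_num))
    rw [hm.integral_influence, map_zero] at h1
    simp only [hψ]
    exact h1
  refine ⟨fun Γ => ?_, fun Γ => hdesign.trace_asympVar_optGamma_le hψ2 hη2 hψ0 hinv Γ,
    hdesign.trace_asympVar_optGamma hψ2 hη2 hψ0 hinv, hdesign.trace_asympVar_zero hψ2 hη2 hψ0,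
    hdesign.trace_asympVar_optGamma_le hψ2 hη2 hψ0 hinv 0⟩
  refine hdesign.tendstoInDistribution_sqrt_card_smul
    (covMat_posSemidef (hdesign.memLp_augInfluence hψ2 hη2 Γ)) ?_
  have hlin := hdesign.tendstoInMeasure_spi hm hh hβV hθV hθF Γ
  rw [← hψ, ← hη] at hlin
  refine tendstoInDistribution_of_tendstoInMeasure_sub _ id
    (hdesign.tendstoInDistribution_sum_augInfluence hψm hηm hψ2 hη2 hψ0 Γ) hlin fun N => ?_
  have hspi : AEMeasurable (spi βV θV θF Γ N) μ := by
    have heq : spi βV θV θF Γ N =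
        fun ω => βV N ω - ∑ k, blockMap Γ k (θV k N ω - θF k N ω) := by
      funext ω
      rw [← toLp_mulVec_stack]
      rfl
    rw [heq]
    refine (hβV.aemeasurable N).sub (Finset.aemeasurable_fun_sum _ fun k _ => ?_)
    exact (blockMap Γ k).continuous.measurable.comp_aemeasurable
      (((hθV k).aemeasurable N).sub ((hθF k).aemeasurable N))
  exact AEMeasurable.const_smul (hspi.sub_const β₀) (√(N : ℝ))
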